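/- Let $k\ge 2$ and $t\ge 4$ be integers and let $c>0$ be a real number. Let $B(k,t,c)$ be the $t\times t$ tridiagonal matrix with lower diagonal $(1,\ldots,1,c,k)$, upper diagonal $(k,k-1,\ldots,k-1,k-c)$ and constant row sum $k$ (so its diagonal is zero), and let $$B(k,3,1)=\begin{pmatrix}0&k&0\\1&0&k-1\\0&k&0\end{pmatrix}.$$ For a finite simple graph $\Gamma$ let $\lambda_2(\Gamma)$ be the second largest eigenvalue (counted with multiplicity) of its adjacency matrix, and let $b(k,\theta)$ denote the maximum order of a connected bipartite $k$-regular graph $\Gamma$ with $\lambda_2(\Gamma)\le\theta$ (with $b(k,\theta)=0$ if there is no such graph). Suppose that $\theta$ is the second largest eigenvalue of $B(k,t,c)$, that is, the second largest of its real eigenvalues counted with multiplicity. Then the orders of the connected bipartite $k$-regular graphs $\Gamma$ with $\lambda_2(\Gamma)\le\theta$ are bounded, and $$b(k,\theta)\le M(k,t,c)=2\left(\sum_{i=0}^{t-4}(k-1)^i+\frac{(k-1)^{t-3}}{c}+\frac{(k-1)^{t-2}}{c}\right).$$ Equality holds if and only if either $1\le c<k$ and there exists a bipartite distance-regular graph whose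 quotient matrix with respect to the distance-partition from a vertex is $B(k,t,c)$, or $c=k$ and there exists a bipartite distance-regular graph whose quotient matrix with respect to the distance-partition from a vertex is $B(k,t-1,1)$. -/

import Mathlib

noncomputable section

/-- `θ` is the second largest eigenvalue of the real square matrix `A`: the real eigenvalues are
listed with their algebraic multiplicities (as the multiset of real roots of the characteristic
polynomial), one largest eigenvalue `μ` is removed once, and `θ` is a largest one among the rest. -/
def IsSecondLargestEigenvalue {n : Type*} [Fintype n] [DecidableEq n]
    (A : Matrix n n ℝ) (θ : ℝ) : Prop :=
  ∃ μ ∈ A.charpoly.roots, (∀ ν ∈ A.charpoly.roots, ν ≤ μ) ∧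
    θ ∈ A.charpoly.roots.erase μ ∧ ∀ ν ∈ A.charpoly.roots.erase μ, ν ≤ θ

/-- The `t × t` tridiagonal matrix `B(k, t, c)` with lower diagonal `(1, …, 1, c, k)`, upper
diagonal `(k, k - 1, …, k - 1, k - c)` and constant row sum `k` (so its diagonal is zero), for
`t ≥ 4`, and also for `t = 3` with `c = 1`. Rows and columns are numbered from `0` to `t - 1`. -/
def tridiagB (k t : ℕ) (c : ℝ) : Matrix (Fin t) (Fin t) ℝ :=
  Matrix.of fun i j =>
    if (j : ℕ) + 1 = i then
      -- lower diagonal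
      if (i : ℕ) + 1 = t then (k : ℝ) else if (i : ℕ) + 2 = t then c else 1
    else if (i : ℕ) + 1 = j then
      -- upper diagonal
      if (i : ℕ) = 0 then (k : ℝ) else if (i : ℕ) + 2 = t then (k : ℝ) - c else (k : ℝ) - 1
    else 0

/-- `M(k, t, c) = 2 (∑_{i=0}^{t-4} (k-1)^i + (k-1)^{t-3} / c + (k-1)^{t-2} / c)`, for `t ≥ 4`. -/
def boundM (k t : ℕ) (c : ℝ) : ℝ :=
  2 * (∑ i ∈ Finset.range (t - 3), ((k : ℝ) - 1) ^ i
    + ((k : ℝ) - 1) ^ (t - 3) / c + ((k : ℝ) - 1) ^ (t - 2) / c)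

open Classical in
/-- The orders of the (finite, simple) connected bipartite `k`-regular graphs whose second largest
adjacency eigenvalue is at most `θ`. -/
def bipartiteOrders (k : ℕ) (θ : ℝ) : Set ℕ :=
  {n | ∃ G : SimpleGraph (Fin n), G.Connected ∧ G.IsBipartite ∧ G.IsRegularOfDegree k ∧
    ∃ μ : ℝ, IsSecondLargestEigenvalue (G.adjMatrix ℝ) μ ∧ μ ≤ θ}

/-- `b(k, θ)`: the maximum order of a connected bipartite `k`-regular graph whose second largest
eigenvalue is at most `θ`. -/
def maxBipartiteOrder (k : ℕ) (θ : ℝ) : ℕ :=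
  sSup (bipartiteOrders k θ)

open Classical in
/-- The number of neighbours of `v` at distance `j` from `u`. -/
def nbrsAtDist {n : ℕ} (G : SimpleGraph (Fin n)) (u v : Fin n) (j : ℕ) : ℕ :=
  (Finset.univ.filter fun w => G.Adj v w ∧ G.dist u w = j).card

/-- A graph is distance-regular if it is connected and, for any two vertices `u`, `v`, the number
of neighbours of `v` at distance `j` from `u` depends only on `j` and on the distance between `u`
and `v`. -/
def IsDistanceRegular {n : ℕ} (G : SimpleGraph (Fin n)) : Prop :=
  G.Connected ∧ ∀ i j : ℕ, ∃ p : ℕ, ∀ u v : Fin n, G.dist u v = i → nbrsAtDist G u v j = p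

/-- The set of vertices at distance `i` from `u`. -/
def distLayer {n : ℕ} (G : SimpleGraph (Fin n)) (u : Fin n) (i : ℕ) : Finset (Fin n) :=
  Finset.univ.filter fun v => G.dist u v = i

/-- `Q` is the quotient matrix of the connected graph `G` with respect to the distance-partition
from `u`: the nonempty cells of that partition are exactly the vertices at distance `0, …, m - 1`
from `u`, and `Q i j` is the average number of neighbours in the `j`-th cell of a vertex in the
`i`-th cell. -/
def IsDistanceQuotientMatrix {n m : ℕ} (G : SimpleGraph (Fin n)) (u : Fin n)
    (Q : Matrix (Fin m) (Fin m) ℝ) : Prop :=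
  (∀ i : ℕ, (distLayer G u i).Nonempty ↔ i < m) ∧
    ∀ i j : Fin m, Q i j =
      (∑ v ∈ distLayer G u i, (nbrsAtDist G u v j : ℝ)) / ((distLayer G u i).card : ℝ)

/-- There is a bipartite distance-regular graph whose quotient matrix with respect to the
distance-partition from a vertex is `Q`. -/
def ExistsBipartiteDRG {m : ℕ} (Q : Matrix (Fin m) (Fin m) ℝ) : Prop :=
  ∃ (n : ℕ) (G : SimpleGraph (Fin n)), G.IsBipartite ∧ IsDistanceRegular G ∧
    ∃ u : Fin n, IsDistanceQuotientMatrix G u Q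

end

/-! Write q = k - 1, t = m + 4, A for the adjacency matrix of a k-regular graph on n vertices, U_i
for `chebU q i` and F_i for `nbPoly q i`. The entries of F_i(A) count non-backtracking walks of
length i (`nbMat_succ_apply`), and U_i = F_i + F_{i-2} + ⋯, so both matrices have nonnegative
integer entries. The characteristic polynomial of B(k,t,c) is (X² - k²)g with g = F_{m+2} + c U_m
(`charpoly_tridiagB`), and M(k,t,c) = 2g(k)/c (`boundM_eq`).

The bound is a linear programming argument. Outside two degenerate cases with c > k, θ is the
largest root of g, and Christoffel–Darboux gives g = (X² - θ²)h with h a nonnegative combination of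
U_m, U_{m-2}, … (`exists_cofactor_of_isSecondLargestEigenvalue`). Now compute tr g(A)h(A) in two
ways (`card_mul_le_of_cofactor`). Spectrally, ±k contribute 2g(k)h(k), and every other eigenvalue x
has |x| ≤ θ and contributes (x² - θ²)h(x)² ≤ 0. Entrywise, the trace is at least n c h(k). Hence n c
≤ 2g(k). The degenerate cases are excluded by hand: one admits no graph, the other gives a strict
inequality.

Equality forces U_m(A) to be a 0/1 matrix with support disjoint from that of F_{m+2}(A), and every
eigenvalue besides ±k to be a root of g, so that g(A) is c times the indicator of one parity class
of pairs (`aeval_quotPoly_eq_of_card_eq`). Read along distances, this gives the intersection numbers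
1, …, 1, c, k (`hasMooreArray_of_extremal`). Conversely, such an array makes every F_i(A), i ≤ m +
2, and hence g(A) explicit, which yields both the order and the spectrum (`HasMooreArray.card_mul`,
`HasMooreArray.exists_isSecondLargestEigenvalue`). If c = k, the layer at distance m + 3 is empty,
and the quotient shrinks to B(k,t-1,1). -/

open Polynomial Matrix

/-! ### Polynomials: recurrences, parity, and values at and beyond k -/

/-- The monic Chebyshev-type polynomials of the second kind with parameter `q`. -/
noncomputable def chebU (q : ℝ) : ℕ → ℝ[X]
  | 0 => 1
  | 1 => X
  | n + 2 => X * chebU q (n + 1) - C q * chebU q n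

/-- The polynomials counting non-backtracking walks in a `(q + 1)`-regular graph. -/
noncomputable def nbPoly (q : ℝ) : ℕ → ℝ[X]
  | 0 => 1
  | 1 => X
  | n + 2 => chebU q (n + 2) - chebU q n

/-- The cofactor of `X ^ 2 - k ^ 2` in the characteristic polynomial of `B(k, m + 4, c)`. -/
noncomputable def quotPoly (q c : ℝ) (m : ℕ) : ℝ[X] := nbPoly q (m + 2) + C c * chebU q m

lemma chebU_zero (q : ℝ) : chebU q 0 = 1 := rfl
lemma chebU_one (q : ℝ) : chebU q 1 = X := rfl
lemma chebU_add_two (q : ℝ) (n : ℕ) :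
    chebU q (n + 2) = X * chebU q (n + 1) - C q * chebU q n := rfl
lemma nbPoly_zero (q : ℝ) : nbPoly q 0 = 1 := rfl
lemma nbPoly_one (q : ℝ) : nbPoly q 1 = X := rfl
lemma nbPoly_add_two (q : ℝ) (n : ℕ) : nbPoly q (n + 2) = chebU q (n + 2) - chebU q n := rfl

lemma nbPoly_two (q : ℝ) : nbPoly q 2 = X * X - C (q + 1) := by
  simp [nbPoly_add_two, chebU_add_two, chebU_zero, chebU_one]; ring

/-- The recurrence starts only at index 3: at index 2 the subtracted constant is q + 1 instead of q,
because a first step has no predecessor to avoid. -/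
lemma nbPoly_add_three (q : ℝ) (n : ℕ) :
    nbPoly q (n + 3) = X * nbPoly q (n + 2) - C q * nbPoly q (n + 1) := by
  rcases n with _ | n
  · simp [nbPoly_add_two, nbPoly_one, chebU_add_two, chebU_zero, chebU_one]; ring
  · simp only [nbPoly_add_two, chebU_add_two]; ring

/-- This identity is what makes X² - k² split off from the characteristic polynomial of B(k,t,c). -/
lemma X_sq_sub_mul_chebU (q : ℝ) (n : ℕ) :
    (X ^ 2 - C ((q + 1) ^ 2)) * chebU q n =
      C (q + 1) * nbPoly q (n + 2) - C q * X * nbPoly q (n + 1) := by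
  rcases n with _ | n
  · simp [nbPoly_add_two, nbPoly_one, chebU_add_two, chebU_zero, chebU_one]; ring
  · simp only [nbPoly_add_two, chebU_add_two, C_add, C_pow, C_1]; ring

lemma chebU_eval_neg (q x : ℝ) (n : ℕ) :
    (chebU q n).eval (-x) = (-1) ^ n * (chebU q n).eval x := by
  induction n using Nat.twoStepInduction with
  | zero => simp [chebU_zero]
  | one => simp [chebU_one]
  | more n h1 h2 => simp only [chebU_add_two, eval_sub, eval_mul, eval_X, eval_C, h1, h2]; ring

lemma quotPoly_eval_neg (q c x : ℝ) (m : ℕ) :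
    (quotPoly q c m).eval (-x) = (-1) ^ m * (quotPoly q c m).eval x := by
  simp only [quotPoly, nbPoly_add_two, eval_add, eval_sub, eval_mul, eval_C, chebU_eval_neg]; ring

lemma degree_C_mul_le_degree (a : ℝ) (p : ℝ[X]) : (C a * p).degree ≤ p.degree := by
  rw [← smul_eq_C_mul]
  exact degree_smul_le a p

lemma chebU_monic_natDegree (q : ℝ) (n : ℕ) :
    (chebU q n).Monic ∧ (chebU q n).natDegree = n := by
  induction n using Nat.strong_induction_on with
  | _ n ih =>
  rcases n with _ | _ | n
  · simp [chebU_zero]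
  · simp [chebU_one, monic_X]
  · obtain ⟨h1, d1⟩ := ih (n + 1) (by omega)
    obtain ⟨h0, d0⟩ := ih n (by omega)
    have hX : (X * chebU q (n + 1)).Monic := monic_X.mul h1
    have hd : (X * chebU q (n + 1)).natDegree = n + 2 := by
      rw [monic_X.natDegree_mul h1, natDegree_X, d1]; ring
    have hlt : (C q * chebU q n).degree < (X * chebU q (n + 1)).degree := by
      refine lt_of_le_of_lt (degree_C_mul_le_degree _ _) ?_
      rw [degree_eq_natDegree h0.ne_zero, degree_eq_natDegree hX.ne_zero, hd, d0]
      exact_mod_cast by omega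
    refine ⟨hX.sub_of_left hlt, ?_⟩
    rw [chebU_add_two, natDegree_eq_of_degree_eq (degree_sub_eq_left_of_degree_lt hlt), hd]

lemma quotPoly_monic (q c : ℝ) (m : ℕ) : (quotPoly q c m).Monic := by
  have h : quotPoly q c m = chebU q (m + 2) + C (c - 1) * chebU q m := by
    simp only [quotPoly, nbPoly_add_two, C_sub, C_1]; ring
  obtain ⟨h2, d2⟩ := chebU_monic_natDegree q (m + 2)
  obtain ⟨h0, d0⟩ := chebU_monic_natDegree q m
  rw [h]
  refine h2.add_of_left (lt_of_le_of_lt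
    (degree_C_mul_le_degree _ _) ?_)
  rw [degree_eq_natDegree h0.ne_zero, degree_eq_natDegree h2.ne_zero, d2, d0]
  exact_mod_cast by omega

/-- The ratio bound carries the induction: U_{n+2} = xU_{n+1} - qU_n > (x - 1)U_{n+1} ≥ qU_{n+1}. -/
lemma chebU_eval_pos {q x : ℝ} (hq : 1 ≤ q) (hx : q + 1 ≤ x) (n : ℕ) :
    0 < (chebU q n).eval x ∧ q * (chebU q n).eval x < (chebU q (n + 1)).eval x := by
  induction n with
  | zero => simp [chebU_zero, chebU_one]; linarith
  | succ n ih =>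
    obtain ⟨h0, h1⟩ := ih
    have hp : 0 < (chebU q (n + 1)).eval x := by nlinarith
    refine ⟨hp, ?_⟩
    simp only [chebU_add_two, eval_sub, eval_mul, eval_X, eval_C]
    nlinarith

lemma nbPoly_eval_pos {q x : ℝ} (hq : 1 ≤ q) (hx : q + 1 ≤ x) (n : ℕ) :
    0 < (nbPoly q (n + 2)).eval x := by
  obtain ⟨h0, h1⟩ := chebU_eval_pos hq hx n
  obtain ⟨h2, h3⟩ := chebU_eval_pos hq hx (n + 1)
  rw [nbPoly_add_two, eval_sub]
  nlinarith

lemma quotPoly_eval_pos {q c x : ℝ} (hq : 1 ≤ q) (hc : 0 < c) (hx : q + 1 ≤ x) (m : ℕ) :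
    0 < (quotPoly q c m).eval x := by
  rw [quotPoly, eval_add, eval_mul, eval_C]
  have := nbPoly_eval_pos hq hx m
  have := (chebU_eval_pos hq hx m).1
  positivity

/-- g is positive on [k, ∞) and even or odd. This makes k the top eigenvalue of B(k,t,c), the one
removed in the definition of θ. -/
lemma abs_lt_of_isRoot_quotPoly {q c x : ℝ} {m : ℕ} (hq : 1 ≤ q) (hc : 0 < c)
    (h : (quotPoly q c m).eval x = 0) : |x| < q + 1 := by
  rw [abs_lt]
  constructor <;> by_contra! hx
  · have := quotPoly_eval_pos hq hc (x := -x) (by linarith) m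
    rw [quotPoly_eval_neg, h, mul_zero] at this
    exact lt_irrefl _ this
  · have := quotPoly_eval_pos hq hc hx m
    rw [h] at this
    exact lt_irrefl _ this

lemma chebU_eval_add_one (q : ℝ) (n : ℕ) :
    (chebU q n).eval (q + 1) = ∑ i ∈ Finset.range (n + 1), q ^ i := by
  have h : (chebU q n).eval (q + 1) = ∑ i ∈ Finset.range (n + 1), q ^ i ∧
      (chebU q (n + 1)).eval (q + 1) = ∑ i ∈ Finset.range (n + 2), q ^ i := by
    induction n with
    | zero => simp [chebU_zero, chebU_one, Finset.sum_range_succ]; ring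
    | succ n ih =>
      refine ⟨ih.2, ?_⟩
      simp only [chebU_add_two, eval_sub, eval_mul, eval_X, eval_C, ih.1, ih.2,
        Finset.sum_range_succ]
      ring
  exact h.1

lemma nbPoly_eval_add_one (q : ℝ) (n : ℕ) :
    (nbPoly q (n + 2)).eval (q + 1) = q ^ (n + 1) + q ^ (n + 2) := by
  simp only [nbPoly_add_two, eval_sub, chebU_eval_add_one, Finset.sum_range_succ]
  ring

lemma boundM_eq (k m : ℕ) {c : ℝ} (hc : 0 < c) :
    boundM k (m + 4) c = 2 * (quotPoly (k - 1) c m).eval (k : ℝ) / c := by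
  have h1 := chebU_eval_add_one ((k : ℝ) - 1) m
  have h2 := nbPoly_eval_add_one ((k : ℝ) - 1) m
  rw [sub_add_cancel] at h1 h2
  rw [quotPoly, eval_add, eval_mul, eval_C, h1, h2, boundM,
    show m + 4 - 3 = m + 1 by omega, show m + 4 - 2 = m + 2 by omega]
  field_simp
  ring

/-! ### Christoffel–Darboux and the largest root of U_m -/

/-- The Christoffel–Darboux formula. -/
lemma christoffel_darboux (q x y : ℝ) (m : ℕ) :
    (x ^ 2 - y ^ 2) * ∑ l ∈ Finset.range (m / 2 + 1),
        q ^ (2 * l) * (chebU q (m - 2 * l)).eval y * (chebU q (m - 2 * l)).eval x =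
      (chebU q (m + 2)).eval x * (chebU q m).eval y -
        (chebU q m).eval x * (chebU q (m + 2)).eval y := by
  induction m using Nat.twoStepInduction with
  | zero => simp [chebU_zero, chebU_one, chebU_add_two]; ring
  | one => simp [chebU_one, chebU_zero, chebU_add_two]; ring
  | more m ih _ =>
    rw [show (m + 2) / 2 + 1 = (m / 2 + 1) + 1 by omega, Finset.sum_range_succ']
    have : ∀ l, m + 2 - 2 * (l + 1) = m - 2 * l := fun l => by omega
    simp only [this, show ∀ l, q ^ (2 * (l + 1)) = q ^ 2 * q ^ (2 * l) from fun l => by ring,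
      mul_assoc (q ^ 2), ← Finset.mul_sum]
    rw [mul_add, mul_left_comm, ih]
    -- Eliminating the odd index leaves a recurrence in steps of two with coefficients in z², which
    -- matches a sum over indices of one parity.
    have e (z : ℝ) : (chebU q (m + 2 + 2)).eval z = (z ^ 2 - 2 * q) * (chebU q (m + 2)).eval z
        - q ^ 2 * (chebU q m).eval z := by
      rw [chebU_add_two, chebU_add_two, chebU_add_two]
      simp only [eval_sub, eval_mul, eval_X, eval_C]; ring
    simp only [e, mul_zero, Nat.sub_zero, pow_zero, one_mul]
    ring

lemma chebU_eval_cos (r φ : ℝ) (n : ℕ) :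
    (chebU (r ^ 2) n).eval (2 * r * Real.cos φ) * Real.sin φ =
      r ^ n * Real.sin ((n + 1) * φ) := by
  induction n using Nat.twoStepInduction with
  | zero => simp [chebU_zero]
  | one => simp [chebU_one, show ((1 : ℝ) + 1) * φ = 2 * φ by ring, Real.sin_two_mul]; ring
  | more n h1 h2 =>
    simp only [chebU_add_two, eval_sub, eval_mul, eval_X, eval_C, sub_mul]
    rw [mul_assoc (2 * r * _), h2, mul_assoc (r ^ 2), h1]
    push_cast
    rw [show ((n : ℝ) + 2 + 1) * φ = ((n : ℝ) + 1 + 1) * φ + φ by ring,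
      show ((n : ℝ) + 1) * φ = ((n : ℝ) + 1 + 1) * φ - φ by ring, Real.sin_add, Real.sin_sub]
    ring

lemma chebU_eval_pos_of_two_mul_le {r x : ℝ} (hr : 0 < r) (hx : 2 * r ≤ x) (n : ℕ) :
    0 < (chebU (r ^ 2) n).eval x ∧
      r * (chebU (r ^ 2) n).eval x < (chebU (r ^ 2) (n + 1)).eval x := by
  induction n with
  | zero => simp [chebU_zero, chebU_one]; linarith
  | succ n ih =>
    obtain ⟨h0, h1⟩ := ih
    have hp : 0 < (chebU (r ^ 2) (n + 1)).eval x := lt_trans (by positivity) h1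
    refine ⟨hp, ?_⟩
    simp only [chebU_add_two, eval_sub, eval_mul, eval_X, eval_C]
    nlinarith

/-- Positivity of the Chebyshev-type polynomials beyond the largest root of the `m`-th one. -/
lemma chebU_eval_pos_of_cos_lt {r x : ℝ} {m : ℕ} (hm : 1 ≤ m) (hr : 0 < r)
    (hx : 2 * r * Real.cos (Real.pi / (m + 1)) < x) {j : ℕ} (hj : j ≤ m) :
    0 < (chebU (r ^ 2) j).eval x := by
  rcases le_or_gt (2 * r) x with h | h
  · exact (chebU_eval_pos_of_two_mul_le hr h j).1
  have hm' : (1 : ℝ) ≤ m := by exact_mod_cast hm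
  have hπ := Real.pi_pos
  have hα1 : Real.pi / (m + 1) ≤ Real.pi := div_le_self hπ.le (by linarith)
  have hα0 : 0 ≤ Real.pi / (m + 1) := by positivity
  set y := x / (2 * r) with hy
  have hxy : x = 2 * r * y := by rw [hy]; field_simp
  have hy1 : y < 1 := by rw [hy, div_lt_one (by positivity)]; exact h
  have hy0 : Real.cos (Real.pi / (m + 1)) < y := by rw [hy, lt_div_iff₀ (by positivity)]; linarith
  have hym : -1 ≤ y := (Real.neg_one_le_cos _).trans hy0.le
  have hφ0 : 0 < Real.arccos y := Real.arccos_pos.2 hy1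
  have hφ1 : Real.arccos y < Real.pi / (m + 1) := by
    by_contra! hcon
    have := Real.cos_le_cos_of_nonneg_of_le_pi hα0 (Real.arccos_le_pi y) hcon
    rw [Real.cos_arccos hym hy1.le] at this
    linarith
  have hs : 0 < Real.sin (Real.arccos y) := Real.sin_pos_of_pos_of_lt_pi hφ0 (by linarith)
  have hj' : (j : ℝ) ≤ m := by exact_mod_cast hj
  have hsj : 0 < Real.sin ((j + 1) * Real.arccos y) := by
    refine Real.sin_pos_of_pos_of_lt_pi (by positivity) ?_
    calc ((j : ℝ) + 1) * Real.arccos y ≤ (m + 1) * Real.arccos y := by gcongr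
      _ < (m + 1) * (Real.pi / (m + 1)) := by gcongr
      _ = Real.pi := by field_simp
  have key := chebU_eval_cos r (Real.arccos y) j
  rw [Real.cos_arccos hym hy1.le, ← hxy] at key
  have : 0 < (chebU (r ^ 2) j).eval x * Real.sin (Real.arccos y) := by rw [key]; positivity
  exact pos_of_mul_pos_left this hs.le

lemma quotPoly_eval_cos_neg {r c : ℝ} {m : ℕ} (hm : 2 ≤ m) (hr : 0 < r) :
    (quotPoly (r ^ 2) c m).eval (2 * r * Real.cos (Real.pi / (m + 1))) < 0 := by
  have hm' : (2 : ℝ) ≤ m := by exact_mod_cast hm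
  have hπ := Real.pi_pos
  set φ := Real.pi / (m + 1) with hφ
  have hφm : (m + 1) * φ = Real.pi := by rw [hφ]; field_simp
  have hφ0 : 0 < φ := by positivity
  have h2 : 2 * φ < Real.pi := by nlinarith
  have hs : 0 < Real.sin φ := Real.sin_pos_of_pos_of_lt_pi hφ0 (by linarith)
  have h0 : (chebU (r ^ 2) m).eval (2 * r * Real.cos φ) = 0 := by
    have := chebU_eval_cos r φ m
    rw [hφm, Real.sin_pi, mul_zero] at this
    exact (mul_eq_zero.1 this).resolve_right hs.ne'
  have h1 : (chebU (r ^ 2) (m + 2)).eval (2 * r * Real.cos φ) < 0 := by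
    have := chebU_eval_cos r φ (m + 2)
    push_cast at this
    -- Since (m + 1)φ = π, U_{m+2} becomes -r^{m+2} sin(2φ) / sin φ, which is negative because m ≥ 2
    -- makes 2φ < π. At m = 1 it would vanish.
    rw [show ((m : ℝ) + 2 + 1) * φ = 2 * φ + Real.pi by rw [← hφm]; ring, Real.sin_add_pi] at this
    have h3 : 0 < Real.sin (2 * φ) := Real.sin_pos_of_pos_of_lt_pi (by linarith) h2
    have : 0 < r ^ (m + 2) * Real.sin (2 * φ) := by positivity
    nlinarith
  rw [quotPoly, nbPoly_add_two, eval_add, eval_sub, eval_mul, h0]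
  linarith

/-! ### The characteristic polynomial of B(k,t,c) -/

/-- The three-term recurrence for the leading principal minors of a tridiagonal matrix. -/
lemma det_tridiagonal_add_two {R : Type*} [CommRing R] (f : ℕ → ℕ → R)
    (hlow : ∀ i j, j + 1 < i → f i j = 0) (hup : ∀ i j, i + 1 < j → f i j = 0) (n : ℕ) :
    (Matrix.of fun i j : Fin (n + 2) => f i j).det =
      f (n + 1) (n + 1) * (Matrix.of fun i j : Fin (n + 1) => f i j).det -
        f (n + 1) n * f n (n + 1) * (Matrix.of fun i j : Fin n => f i j).det := by
  rw [Matrix.det_succ_row _ (Fin.last (n + 1)), Fin.sum_univ_castSucc, Fin.sum_univ_castSucc]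
  have h0 : ∀ i : Fin n, f (n + 1) i = 0 := fun i => hlow _ _ (by omega)
  have hminor : ((Matrix.of fun i j : Fin (n + 2) => f i j).submatrix
      (Fin.last (n + 1)).succAbove (Fin.last (n + 1)).succAbove) =
      Matrix.of fun i j : Fin (n + 1) => f i j := by
    ext i j; simp
  -- After the last row and the penultimate column are deleted, the last column has a single
  -- possibly nonzero entry, so it is expanded once more.
  have hminor2 : ((Matrix.of fun i j : Fin (n + 2) => f i j).submatrix
      (Fin.last (n + 1)).succAbove (Fin.castSucc (Fin.last n)).succAbove).det =
      f n (n + 1) * (Matrix.of fun i j : Fin n => f i j).det := by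
    rw [Matrix.det_succ_column _ (Fin.last n), Fin.sum_univ_castSucc]
    have hz : ∀ i : Fin n, f i (n + 1) = 0 := fun i => hup _ _ (by omega)
    have hs : ((Fin.castSucc (Fin.last n)).succAbove (Fin.last n) : Fin (n + 2)) =
        Fin.last (n + 1) := by
      rw [Fin.succAbove_of_le_castSucc _ _ le_rfl]; rfl
    have hsub : (((Matrix.of fun i j : Fin (n + 2) => f i j).submatrix
        (Fin.last (n + 1)).succAbove (Fin.castSucc (Fin.last n)).succAbove).submatrix
        (Fin.last n).succAbove (Fin.last n).succAbove) =
        Matrix.of fun i j : Fin n => f i j := by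
      ext i j
      have : (Fin.castSucc (Fin.last n)).succAbove (Fin.castSucc j) =
          Fin.castSucc (Fin.castSucc j) :=
        Fin.succAbove_of_castSucc_lt _ _ (by simp [Fin.lt_def])
      simp [this]
    rw [hsub]
    simp [hs, hz, ← two_mul, pow_mul]
  rw [hminor, hminor2]
  simp [h0]
  ring

/-- The entries of the characteristic matrix of `B(k, t, c)`, as a function of natural numbers. -/
noncomputable def tridiagEntry (k t : ℕ) (c : ℝ) (i j : ℕ) : ℝ[X] :=
  (if i = j then X else 0) - C (
    if j + 1 = i then
      if i + 1 = t then (k : ℝ) else if i + 2 = t then c else 1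
    else if i + 1 = j then
      if i = 0 then (k : ℝ) else if i + 2 = t then (k : ℝ) - c else (k : ℝ) - 1
    else 0)

lemma charmatrix_tridiagB (k t : ℕ) (c : ℝ) :
    (tridiagB k t c).charmatrix = Matrix.of fun i j : Fin t => tridiagEntry k t c i j := by
  ext1 i j
  simp only [Matrix.charmatrix_apply, tridiagEntry, tridiagB, Matrix.of_apply, Matrix.diagonal_apply,
    Fin.ext_iff]

lemma det_tridiagEntry (k m : ℕ) (c : ℝ) (n : ℕ) (hn : n ≤ m + 2) :
    (Matrix.of fun i j : Fin n => tridiagEntry k (m + 4) c i j).det = nbPoly (k - 1) n := by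
  induction n using Nat.strong_induction_on with
  | _ n ih =>
  match n with
  | 0 => simp [nbPoly_zero]
  | 1 => simp [nbPoly_one, tridiagEntry]
  | 2 =>
    rw [Matrix.det_fin_two]
    simp [nbPoly_two, tridiagEntry]
  | n + 3 =>
    rw [det_tridiagonal_add_two, ih (n + 2) (by omega) (by omega), ih (n + 1) (by omega) (by omega),
      nbPoly_add_three]
    · simp only [tridiagEntry]
      simp [show ¬ (n = m) by omega, show ¬ (n = m + 1) by omega, show ¬ (n + 1 + 1 = n) by omega]
    · intro i j h
      simp [tridiagEntry, show ¬ (i = j) by omega, show ¬ (j + 1 = i) by omega,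
        show ¬ (i + 1 = j) by omega]
    · intro i j h
      simp [tridiagEntry, show ¬ (i = j) by omega, show ¬ (j + 1 = i) by omega,
        show ¬ (i + 1 = j) by omega]

lemma charpoly_tridiagB (k m : ℕ) (c : ℝ) :
    (tridiagB k (m + 4) c).charpoly = (X ^ 2 - C ((k : ℝ) ^ 2)) * quotPoly (k - 1) c m := by
  have hl : ∀ i j, j + 1 < i → tridiagEntry k (m + 4) c i j = 0 := fun i j h => by
    simp [tridiagEntry, show ¬ (i = j) by omega, show ¬ (j + 1 = i) by omega,
        show ¬ (i + 1 = j) by omega]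
  have hu : ∀ i j, i + 1 < j → tridiagEntry k (m + 4) c i j = 0 := fun i j h => by
    simp [tridiagEntry, show ¬ (i = j) by omega, show ¬ (j + 1 = i) by omega,
        show ¬ (i + 1 = j) by omega]
  have key := X_sq_sub_mul_chebU ((k : ℝ) - 1) m
  rw [sub_add_cancel] at key
  have e1 : tridiagEntry k (m + 4) c (m + 3) (m + 3) = X := by simp [tridiagEntry]
  have e2 : tridiagEntry k (m + 4) c (m + 2) (m + 2) = X := by simp [tridiagEntry]
  have e3 : tridiagEntry k (m + 4) c (m + 3) (m + 2) = - C (k : ℝ) := by simp [tridiagEntry]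
  have e4 : tridiagEntry k (m + 4) c (m + 2) (m + 3) = - C ((k : ℝ) - c) := by simp [tridiagEntry]
  have e5 : tridiagEntry k (m + 4) c (m + 2) (m + 1) = - C c := by simp [tridiagEntry]
  have e6 : tridiagEntry k (m + 4) c (m + 1) (m + 2) = - C ((k : ℝ) - 1) := by
    simp [tridiagEntry]
  -- The minors of size at most m + 2 do not see c and equal F_n. The last two rows are unrolled by
  -- the recurrence, giving (X² - k²)F_{m+2} + c(kF_{m+2} - qXF_{m+1}).
  rw [Matrix.charpoly, charmatrix_tridiagB, det_tridiagonal_add_two _ hl hu,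
    det_tridiagonal_add_two _ hl hu, det_tridiagEntry _ _ _ _ le_rfl,
    det_tridiagEntry _ _ _ _ (by omega), quotPoly, mul_add, mul_left_comm, key,
    e1, e2, e3, e4, e5, e6]
  simp only [C_sub, C_pow, C_1]
  ring

lemma roots_charpoly_tridiagB (k m : ℕ) (c : ℝ) :
    (tridiagB k (m + 4) c).charpoly.roots =
      (k : ℝ) ::ₘ (-(k : ℝ)) ::ₘ (quotPoly (k - 1) c m).roots := by
  have h : (X ^ 2 - C ((k : ℝ) ^ 2)) * quotPoly (k - 1) c m =
      (X - C (k : ℝ)) * ((X - C (-(k : ℝ))) * quotPoly (k - 1) c m) := by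
    simp only [C_pow, C_neg]; ring
  have h0 := (quotPoly_monic ((k : ℝ) - 1) c m).ne_zero
  rw [charpoly_tridiagB, h, roots_mul, roots_mul, roots_X_sub_C, roots_X_sub_C]
  · rfl
  · exact mul_ne_zero (X_sub_C_ne_zero _) h0
  · exact mul_ne_zero (X_sub_C_ne_zero _) (mul_ne_zero (X_sub_C_ne_zero _) h0)

/-! ### The eigenvalue θ and the cofactor of X² - θ² -/

/-- The second largest eigenvalue of `B(k, m + 4, c)` is `-k` or a root of `quotPoly`, and it
bounds both. -/
lemma IsSecondLargestEigenvalue.tridiagB {k m : ℕ} {c θ : ℝ} (hk : 2 ≤ k) (hc : 0 < c)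
    (h : IsSecondLargestEigenvalue (tridiagB k (m + 4) c) θ) :
    (θ = -k ∨ (quotPoly (k - 1) c m).eval θ = 0) ∧ -(k : ℝ) ≤ θ ∧
      ∀ x, (quotPoly (k - 1) c m).eval x = 0 → x ≤ θ := by
  have hk' : (2 : ℝ) ≤ k := by exact_mod_cast hk
  have h0 := (quotPoly_monic ((k : ℝ) - 1) c m).ne_zero
  obtain ⟨μ, hμ, hmax, hθ, hθm⟩ := h
  rw [roots_charpoly_tridiagB] at *
  have hkμ := hmax k (by simp)
  have hμk : μ = k := by
    simp only [Multiset.mem_cons, mem_roots h0, IsRoot.def] at hμ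
    rcases hμ with h | h | h
    · exact h
    · linarith
    · have := abs_lt_of_isRoot_quotPoly (by linarith) hc h
      have := le_abs_self μ
      linarith
  subst hμk
  simp only [Multiset.erase_cons_head, Multiset.mem_cons, mem_roots h0, IsRoot.def] at hθ hθm
  exact ⟨hθ, hθm _ (Or.inl rfl), fun x hx => hθm x (Or.inr hx)⟩

/-- In all but two degenerate cases, dividing `quotPoly` by `X ^ 2 - θ ^ 2` gives a nonnegative
combination of the polynomials `chebU`. -/
lemma exists_cofactor_of_isSecondLargestEigenvalue {k m : ℕ} {c θ : ℝ} (hk : 2 ≤ k) (hc : 0 < c)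
    (h : IsSecondLargestEigenvalue (tridiagB k (m + 4) c) θ) :
    (0 ≤ θ ∧ θ < k ∧ ∃ w : ℕ → ℝ, 0 < w 0 ∧ (∀ l, 0 ≤ w l) ∧
      ∀ x, (x ^ 2 - θ ^ 2) *
        ∑ l ∈ Finset.range (m / 2 + 1), w l * (chebU (k - 1) (m - 2 * l)).eval x =
          (quotPoly (k - 1) c m).eval x) ∨
    (k < c ∧ θ = -k) ∨ (m = 1 ∧ k < c ∧ θ = 0) := by
  have hk' : (2 : ℝ) ≤ k := by exact_mod_cast hk
  obtain ⟨hθ, hθk, hθm⟩ := h.tridiagB hk hc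
  have hroot : θ ≠ -k → (quotPoly (k - 1) c m).eval θ = 0 ∧ 0 ≤ θ ∧ θ < k := by
    intro hne
    have h1 := hθ.resolve_left hne
    have h2 := hθm (-θ) (by rw [quotPoly_eval_neg, h1, mul_zero])
    have h3 := abs_lt_of_isRoot_quotPoly (by linarith) hc h1
    have := le_abs_self θ
    exact ⟨h1, by linarith, by linarith⟩
  rcases lt_trichotomy m 1 with hm | hm | hm
  · obtain rfl : m = 0 := by omega
    have hg : ∀ x, (quotPoly ((k : ℝ) - 1) c 0).eval x = x ^ 2 - (k - c) := by
      intro x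
      -- The polynomial x² - (k - c) has real roots exactly when c ≤ k; otherwise only -k is left
      -- for θ.
      simp [quotPoly, nbPoly_add_two, chebU_add_two, chebU_zero, chebU_one]; ring
    by_cases hne : θ = -k
    · right; left
      refine ⟨?_, hne⟩
      by_contra! hcon
      have := hθm (√(k - c)) (by rw [hg, Real.sq_sqrt (by linarith)]; ring)
      have := Real.sqrt_nonneg (k - c)
      linarith
    · left
      obtain ⟨h1, h2, h3⟩ := hroot hne
      refine ⟨h2, h3, fun _ => 1, by simp, by simp, fun x => ?_⟩
      rw [hg] at h1 ⊢
      simp [chebU_zero]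
      linarith
  · subst hm
    have hg : ∀ x, (quotPoly ((k : ℝ) - 1) c 1).eval x = x * (x ^ 2 - (2 * k - 1 - c)) := by
      intro x
      simp [quotPoly, nbPoly_add_two, chebU_add_two, chebU_zero, chebU_one]; ring
    have h00 := hθm 0 (by rw [hg]; ring)
    obtain ⟨h1, h2, h3⟩ := hroot (by intro h; linarith)
    rw [hg] at h1
    -- Beyond 2k - 1 the only real root is 0. Otherwise θ is the root √(2k - 1 - c), and the
    -- cofactor is U_1 = X.
    by_cases hc2 : 2 * k - 1 < c
    · right; right
      refine ⟨rfl, by linarith, ?_⟩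
      rcases mul_eq_zero.1 h1 with h1 | h1
      · exact h1
      · nlinarith
    · left
      have hr := hθm (√(2 * k - 1 - c)) (by rw [hg, Real.sq_sqrt (by linarith)]; ring)
      have hsq := Real.sq_sqrt (show 0 ≤ 2 * (k : ℝ) - 1 - c by linarith)
      have hs0 := Real.sqrt_nonneg (2 * (k : ℝ) - 1 - c)
      refine ⟨h2, h3, fun _ => 1, by simp, by simp, fun x => ?_⟩
      rw [hg]
      simp [chebU_one]
      rcases mul_eq_zero.1 h1 with h1 | h1
      · subst h1
        have : √(2 * (k : ℝ) - 1 - c) = 0 := le_antisymm hr hs0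
        rw [this] at hsq
        linear_combination (-x) * hsq
      · linear_combination (-x) * h1
  · left
    set r := √((k : ℝ) - 1) with hrdef
    have hr : 0 < r := Real.sqrt_pos.2 (by linarith)
    have hr2 : r ^ 2 = (k : ℝ) - 1 := Real.sq_sqrt (by linarith)
    have hm2 : (2 : ℝ) ≤ m := by exact_mod_cast hm
    -- ρ is the largest root of U_m. As g(ρ) < 0 < g(k), the largest root θ of g lies beyond ρ,
    -- where all U_j with j ≤ m are positive; this makes the weights nonnegative.
    set ρ := 2 * r * Real.cos (Real.pi / (m + 1)) with hρ
    have hneg : (quotPoly ((k : ℝ) - 1) c m).eval ρ < 0 := hr2 ▸ quotPoly_eval_cos_neg hm hr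
    have hρ0 : 0 ≤ ρ := by
      have hπ := Real.pi_pos
      have : 0 ≤ Real.cos (Real.pi / (m + 1)) :=
        Real.cos_nonneg_of_neg_pi_div_two_le_of_le
          (by have : 0 ≤ Real.pi / (m + 1) := by positivity
              linarith)
          (div_le_div_of_nonneg_left hπ.le (by norm_num) (by linarith))
      positivity
    have hρk : ρ < k := by
      by_contra! hcon
      exact absurd (quotPoly_eval_pos (q := (k : ℝ) - 1) (by linarith) hc (by linarith) m)
        hneg.not_gt
    have hposk := quotPoly_eval_pos (q := (k : ℝ) - 1) (x := k) (by linarith) hc (by linarith) m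
    have hρθ : ρ < θ := by
      obtain ⟨x, hx, hx0⟩ := intermediate_value_Ioo hρk.le
        (quotPoly ((k : ℝ) - 1) c m).continuous.continuousOn ⟨hneg, hposk⟩
      exact hx.1.trans_le (hθm x hx0)
    obtain ⟨h1, h2, h3⟩ := hroot (by intro h; linarith)
    have hpos : ∀ j ≤ m, 0 < (chebU ((k : ℝ) - 1) j).eval θ := fun j hj =>
      hr2 ▸ chebU_eval_pos_of_cos_lt (by omega) hr hρθ hj
    have hUm := hpos m le_rfl
    refine ⟨h2, h3, fun l => ((k : ℝ) - 1) ^ (2 * l) * (chebU (k - 1) (m - 2 * l)).eval θ /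
      (chebU (k - 1) m).eval θ, by simpa using div_pos hUm hUm, fun l => ?_, fun x => ?_⟩
    · have := hpos (m - 2 * l) (by omega)
      have : 0 ≤ (k : ℝ) - 1 := by linarith
      positivity
    · have hcd := christoffel_darboux ((k : ℝ) - 1) x θ m
      simp only [div_mul_eq_mul_div, ← Finset.sum_div]
      rw [mul_div_assoc', hcd, div_eq_iff hUm.ne']
      -- g(θ) = 0 means U_{m+2}(θ) = (1 - c)U_m(θ), which turns the Christoffel–Darboux numerator
      -- into U_m(θ)g(x).
      rw [quotPoly, nbPoly_add_two, eval_add, eval_sub, eval_mul, eval_C] at h1 ⊢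
      linear_combination -(chebU ((k : ℝ) - 1) m).eval x * h1

/-! ### Traces and row sums of polynomials in a matrix -/

section Spectral

variable {V : Type*} [Fintype V] [DecidableEq V]

lemma Matrix.IsHermitian.trace_aeval {A : Matrix V V ℝ} (hA : A.IsHermitian) (p : ℝ[X]) :
    (aeval A p).trace = (A.charpoly.roots.map fun x => p.eval x).sum := by
  have h1 : aeval A p = Unitary.conjStarAlgAut ℝ _ hA.eigenvectorUnitary
      (Matrix.diagonal fun i => p.eval (hA.eigenvalues i)) := by
    conv_lhs => rw [hA.spectral_theorem]
    rw [aeval_algHom_apply]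
    congr 1
    have := aeval_algHom_apply (Matrix.diagonalAlgHom ℝ (n := V) (α := ℝ)) hA.eigenvalues p
    rw [aeval_pi_apply] at this
    simpa using this
  rw [h1, hA.roots_charpoly_eq_eigenvalues, Unitary.conjStarAlgAut_apply, Matrix.trace_mul_cycle]
  simp [Matrix.trace_diagonal]

lemma Matrix.roots_charpoly_neg (A : Matrix V V ℝ) :
    (-A).charpoly.roots = A.charpoly.roots.map fun x => -x := by
  have h : (-A).charmatrix = -((A.charmatrix).map (compRingHom (-X : ℝ[X]))) := by
    ext1 i j
    simp only [Matrix.charmatrix_apply, Matrix.neg_apply, Matrix.map_apply, Matrix.diagonal_apply]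
    split_ifs <;> simp [add_comm]
  have h2 : (-A).charpoly = (-1) ^ Fintype.card V * A.charpoly.comp (-X) := by
    rw [Matrix.charpoly, h, Matrix.det_neg, Matrix.charpoly]
    congr 1
    rw [← coe_compRingHom_apply, RingHom.map_det]
    rfl
  rw [h2, ← roots_comp_neg_X, show ((-1 : ℝ[X]) ^ Fintype.card V) = C ((-1) ^ Fintype.card V) by simp,
    roots_C_mul _ (by simp)]

lemma Matrix.aeval_mulVec_const (A : Matrix V V ℝ) {x : ℝ}
    (h : ∀ u, ∑ v, A u v = x) (p : ℝ[X]) (u : V) : ∑ v, aeval A p u v = p.eval x := by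
  have hv : A *ᵥ (fun _ => (1 : ℝ)) = x • fun _ => (1 : ℝ) := by
    ext u; simp [Matrix.mulVec, dotProduct, h]
  have key : aeval A p *ᵥ (fun _ => (1 : ℝ)) = p.eval x • fun _ => (1 : ℝ) := by
    induction p using Polynomial.induction_on' with
    | add p r hp hr => simp only [map_add, Matrix.add_mulVec, hp, hr, eval_add, add_smul]
    | monomial n a =>
      have hn : A ^ n *ᵥ (fun _ => (1 : ℝ)) = x ^ n • fun _ => (1 : ℝ) := by
        induction n with
        | zero => simp
        | succ n ih =>
          rw [pow_succ, ← Matrix.mulVec_mulVec, hv, Matrix.mulVec_smul, ih, smul_smul]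
          ring_nf
      rw [aeval_monomial, eval_monomial, ← Matrix.mulVec_mulVec, hn, Matrix.mulVec_smul,
        Algebra.algebraMap_eq_smul_one, Matrix.smul_mulVec, Matrix.one_mulVec, smul_smul, mul_comm]
  simpa [Matrix.mulVec, dotProduct] using congrFun key u

lemma Matrix.IsSymm.aeval {A : Matrix V V ℝ} (hA : A.IsSymm) (p : ℝ[X]) :
    (aeval A p).IsSymm := by
  induction p using Polynomial.induction_on' with
  | add p r hp hr => rw [map_add]; exact hp.add hr
  | monomial n a =>
    rw [aeval_monomial, Algebra.algebraMap_eq_smul_one, smul_one_mul]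
    exact (hA.pow n).smul a

lemma Matrix.IsSymm.trace_aeval_mul {A : Matrix V V ℝ} (hA : A.IsSymm) (p r : ℝ[X]) :
    (Polynomial.aeval A (p * r)).trace =
      ∑ u, ∑ v, Polynomial.aeval A p u v * Polynomial.aeval A r u v := by
  rw [map_mul, Matrix.trace]
  refine Finset.sum_congr rfl fun u _ => ?_
  rw [Matrix.diag_apply, Matrix.mul_apply]
  refine Finset.sum_congr rfl fun v _ => ?_
  rw [(hA.aeval r).apply]

end Spectral

/-! ### Non-backtracking walks and the matrices F_i(A), U_i(A) -/

section Walks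

variable {V : Type*} [Fintype V] [DecidableEq V] (G : SimpleGraph V) [DecidableRel G.Adj]

/-- The number of non-backtracking walks of length `i + 1` from `u` whose last step is from `x`
to `v`. -/
def nbCount (u : V) : ℕ → V → V → ℕ
  | 0, x, v => if G.Adj x v ∧ x = u then 1 else 0
  | i + 1, x, v => if G.Adj x v then ∑ y, if y = v then 0 else nbCount u i y x else 0

variable {G}

lemma nbCount_eq_zero_of_not_adj {u x v : V} {i : ℕ} (h : ¬ G.Adj x v) :
    nbCount G u i x v = 0 := by
  cases i <;> simp [nbCount, h]

lemma exists_walk_of_nbCount_ne_zero {u x v : V} {i : ℕ} (h : nbCount G u i x v ≠ 0) :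
    ∃ p : G.Walk u v, p.length = i + 1 := by
  induction i generalizing x v with
  | zero =>
    simp only [nbCount, ne_eq, ite_eq_right_iff, one_ne_zero, imp_false, not_not] at h
    obtain ⟨h1, rfl⟩ := h
    exact ⟨h1.toWalk, rfl⟩
  | succ i ih =>
    have hadj : G.Adj x v := by
      by_contra hn; exact h (nbCount_eq_zero_of_not_adj hn)
    rw [nbCount, if_pos hadj] at h
    obtain ⟨y, -, hy⟩ := Finset.exists_ne_zero_of_sum_ne_zero h
    obtain ⟨p, hp⟩ := ih (x := y) (v := x) (by intro h0; simp [h0] at hy)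
    exact ⟨p.concat hadj, by simp [hp]⟩

/-- Append a step x → v to every walk ending at x: the result is non-backtracking unless the
previous vertex was v, and those exceptions form the second sum. -/
lemma sum_nbCount_succ (u v : V) (i : ℕ) :
    ∑ x, nbCount G u (i + 1) x v + ∑ x, nbCount G u i v x =
      ∑ x, if G.Adj x v then ∑ y, nbCount G u i y x else 0 := by
  rw [← Finset.sum_add_distrib]
  refine Finset.sum_congr rfl fun x _ => ?_
  split_ifs with h
  · rw [nbCount, if_pos h, ← Finset.sum_erase_add _ _ (Finset.mem_univ v), if_pos rfl, add_zero,
      ← Finset.sum_erase_add (a := v) _ (fun y => nbCount G u i y x) (Finset.mem_univ v)]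
    congr 1
    refine Finset.sum_congr rfl fun y hy => if_neg (Finset.ne_of_mem_erase hy)
  · rw [nbCount_eq_zero_of_not_adj h, nbCount_eq_zero_of_not_adj (fun h' => h h'.symm)]

/-- Each walk ending at v has k continuations, exactly one of which backtracks. This identifies the
correction term of `sum_nbCount_succ` as q times the count two steps earlier. -/
lemma sum_nbCount_out {k : ℕ} (hreg : G.IsRegularOfDegree k) (u v : V) (i : ℕ) :
    ∑ x, nbCount G u (i + 1) v x + ∑ y, nbCount G u i y v = k * ∑ y, nbCount G u i y v := by
  have h1 : ∀ x, nbCount G u (i + 1) v x + (if G.Adj v x then nbCount G u i x v else 0) =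
      if G.Adj v x then ∑ y, nbCount G u i y v else 0 := by
    intro x
    split_ifs with h
    · rw [nbCount, if_pos h, ← Finset.sum_erase_add _ _ (Finset.mem_univ x), if_pos rfl, add_zero,
        ← Finset.sum_erase_add (a := x) _ (fun y => nbCount G u i y v) (Finset.mem_univ x)]
      congr 1
      refine Finset.sum_congr rfl fun y hy => if_neg (Finset.ne_of_mem_erase hy)
    · rw [nbCount_eq_zero_of_not_adj h]
  have h2 : ∀ x, (if G.Adj v x then nbCount G u i x v else 0) = nbCount G u i x v := by
    intro x
    split_ifs with h
    · rfl
    · exact (nbCount_eq_zero_of_not_adj fun h' => h h'.symm).symm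
  simp only [h2] at h1
  rw [← Finset.sum_add_distrib, Finset.sum_congr rfl fun x _ => h1 x, ← Finset.sum_filter,
    Finset.sum_const, smul_eq_mul, ← hreg v, ← G.card_neighborFinset_eq_degree,
    SimpleGraph.neighborFinset_eq_filter]

lemma sum_nbCount_zero (u v : V) :
    ∑ x, nbCount G u 0 x v = if G.Adj u v then 1 else 0 := by
  simp only [nbCount]
  rw [Finset.sum_eq_single u]
  · simp
  · intro x _ hx; simp [hx]
  · simp

lemma sum_nbCount_zero_out {k : ℕ} (hreg : G.IsRegularOfDegree k) (u v : V) :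
    ∑ x, nbCount G u 0 v x = if v = u then k else 0 := by
  simp only [nbCount]
  split_ifs with h
  · simp only [h, and_true]
    rw [← Finset.sum_filter, Finset.sum_const, smul_eq_mul, mul_one, ← hreg u,
      ← G.card_neighborFinset_eq_degree, SimpleGraph.neighborFinset_eq_filter]
  · simp [h]

variable (G) in
/-- The matrix of the polynomial `nbPoly` in the adjacency matrix. -/
noncomputable def nbMat (q : ℝ) (i : ℕ) : Matrix V V ℝ := aeval (G.adjMatrix ℝ) (nbPoly q i)

variable (G) in
/-- The matrix of the polynomial `chebU` in the adjacency matrix. -/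
noncomputable def chebMat (q : ℝ) (i : ℕ) : Matrix V V ℝ := aeval (G.adjMatrix ℝ) (chebU q i)

lemma nbMat_zero (q : ℝ) : nbMat G q 0 = 1 := by simp [nbMat, nbPoly_zero]
lemma nbMat_one (q : ℝ) : nbMat G q 1 = G.adjMatrix ℝ := by simp [nbMat, nbPoly_one]
lemma chebMat_zero (q : ℝ) : chebMat G q 0 = 1 := by simp [chebMat, chebU_zero]
lemma chebMat_one (q : ℝ) : chebMat G q 1 = G.adjMatrix ℝ := by simp [chebMat, chebU_one]

lemma chebMat_add_two (q : ℝ) (n : ℕ) :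
    chebMat G q (n + 2) = chebMat G q n + nbMat G q (n + 2) := by
  rw [nbMat, nbPoly_add_two, map_sub, chebMat, chebMat]; abel

lemma nbMat_two_apply (q : ℝ) (u v : V) :
    nbMat G q 2 u v = (∑ x, if G.Adj x v then nbMat G q 1 u x else 0) -
      (q + 1) * if u = v then 1 else 0 := by
  rw [nbMat_one, nbMat, nbPoly_two, map_sub, map_mul, aeval_X, aeval_C, Algebra.algebraMap_eq_smul_one,
    Matrix.sub_apply, Matrix.mul_apply, Matrix.smul_apply, Matrix.one_apply, smul_eq_mul]
  simp [SimpleGraph.adjMatrix_apply]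

lemma nbMat_add_three_apply (q : ℝ) (n : ℕ) (u v : V) :
    nbMat G q (n + 3) u v = (∑ x, if G.Adj x v then nbMat G q (n + 2) u x else 0) -
      q * nbMat G q (n + 1) u v := by
  rw [nbMat, nbPoly_add_three, mul_comm X, map_sub, map_mul, map_mul, aeval_X, aeval_C,
    Algebra.algebraMap_eq_smul_one, smul_one_mul, Matrix.sub_apply, Matrix.mul_apply, Matrix.smul_apply]
  simp [SimpleGraph.adjMatrix_apply, nbMat]

lemma nbMat_succ_apply {k : ℕ} (hreg : G.IsRegularOfDegree k) (i : ℕ) (u v : V) :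
    nbMat G ((k : ℝ) - 1) (i + 1) u v = ((∑ x, nbCount G u i x v : ℕ) : ℝ) := by
  induction i using Nat.strong_induction_on generalizing v with
  | _ i ih =>
  match i with
  | 0 => rw [sum_nbCount_zero, nbMat_one, SimpleGraph.adjMatrix_apply]; simp
  | 1 =>
    have h := congrArg (Nat.cast (R := ℝ)) (sum_nbCount_succ (G := G) u v 0)
    rw [sum_nbCount_zero_out hreg] at h
    rw [nbMat_two_apply]
    simp only [ih 0 one_pos, Nat.cast_add, Nat.cast_ite, Nat.cast_zero] at h ⊢
    push_cast at h ⊢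
    rw [← h]
    simp [eq_comm]
  | i + 2 =>
    have h := congrArg (Nat.cast (R := ℝ)) (sum_nbCount_succ (G := G) u v (i + 1))
    have h' := congrArg (Nat.cast (R := ℝ)) (sum_nbCount_out hreg u v i)
    rw [nbMat_add_three_apply]
    simp only [ih (i + 1) (by omega), ih i (by omega)]
    push_cast at h h' ⊢
    rw [← h]
    linear_combination h'

lemma exists_nat_nbMat {k : ℕ} (hreg : G.IsRegularOfDegree k) (i : ℕ) (u v : V) :
    ∃ p : ℕ, nbMat G ((k : ℝ) - 1) i u v = p := by
  rcases i with _ | i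
  · exact ⟨if u = v then 1 else 0, by simp [nbMat_zero, Matrix.one_apply]⟩
  · exact ⟨_, nbMat_succ_apply hreg i u v⟩

lemma nbMat_nonneg {k : ℕ} (hreg : G.IsRegularOfDegree k) (i : ℕ) (u v : V) :
    0 ≤ nbMat G ((k : ℝ) - 1) i u v := by
  obtain ⟨p, hp⟩ := exists_nat_nbMat hreg i u v
  rw [hp]; positivity

lemma exists_walk_of_nbMat_ne_zero {k : ℕ} (hreg : G.IsRegularOfDegree k) {i : ℕ} {u v : V}
    (h : nbMat G ((k : ℝ) - 1) i u v ≠ 0) : ∃ p : G.Walk u v, p.length = i := by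
  rcases i with _ | i
  · have : u = v := by
      by_contra hne; exact h (by simp [nbMat_zero, hne])
    subst this
    exact ⟨.nil, rfl⟩
  · rw [nbMat_succ_apply hreg] at h
    obtain ⟨x, -, hx⟩ := Finset.exists_ne_zero_of_sum_ne_zero (Nat.cast_ne_zero.1 h)
    exact exists_walk_of_nbCount_ne_zero hx

lemma exists_nat_chebMat {k : ℕ} (hreg : G.IsRegularOfDegree k) (i : ℕ) (u v : V) :
    ∃ p : ℕ, chebMat G ((k : ℝ) - 1) i u v = p := by
  induction i using Nat.twoStepInduction with
  | zero => exact ⟨if u = v then 1 else 0, by simp [chebMat_zero, Matrix.one_apply]⟩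
  | one => exact ⟨if G.Adj u v then 1 else 0, by simp [chebMat_one, SimpleGraph.adjMatrix_apply]⟩
  | more n h _ =>
    obtain ⟨p, hp⟩ := h
    obtain ⟨r, hr⟩ := exists_nat_nbMat hreg (n + 2) u v
    exact ⟨p + r, by rw [chebMat_add_two, Matrix.add_apply, hp, hr]; push_cast; rfl⟩

lemma chebMat_nonneg {k : ℕ} (hreg : G.IsRegularOfDegree k) (i : ℕ) (u v : V) :
    0 ≤ chebMat G ((k : ℝ) - 1) i u v := by
  obtain ⟨p, hp⟩ := exists_nat_chebMat hreg i u v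
  rw [hp]; positivity

lemma chebMat_sub_le {k : ℕ} (hreg : G.IsRegularOfDegree k) (m l : ℕ) (h : 2 * l ≤ m) (u v : V) :
    chebMat G ((k : ℝ) - 1) (m - 2 * l) u v ≤ chebMat G ((k : ℝ) - 1) m u v := by
  induction l with
  | zero => simp
  | succ l ih =>
    refine le_trans ?_ (ih (by omega))
    rw [show m - 2 * l = m - 2 * (l + 1) + 2 by omega, chebMat_add_two, Matrix.add_apply]
    linarith [nbMat_nonneg hreg (m - 2 * (l + 1) + 2) u v]

lemma nbMat_le_chebMat {k : ℕ} (hreg : G.IsRegularOfDegree k) (i : ℕ) (u v : V) :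
    nbMat G ((k : ℝ) - 1) i u v ≤ chebMat G ((k : ℝ) - 1) i u v := by
  rcases i with _ | _ | i
  · rw [nbMat_zero, chebMat_zero]
  · rw [nbMat_one, chebMat_one]
  · rw [chebMat_add_two, Matrix.add_apply]
    linarith [chebMat_nonneg hreg i u v]

omit [DecidableEq V] in
lemma sum_adjMatrix {k : ℕ} (hreg : G.IsRegularOfDegree k) (u : V) :
    ∑ v, G.adjMatrix ℝ u v = k := by
  simp only [SimpleGraph.adjMatrix_apply, Finset.sum_boole, Nat.cast_inj]
  rw [← hreg u, ← G.card_neighborFinset_eq_degree, SimpleGraph.neighborFinset_eq_filter]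

omit [Fintype V] [DecidableEq V] in
lemma adjMatrix_isHermitian : (G.adjMatrix ℝ).IsHermitian := by
  rw [Matrix.IsHermitian, Matrix.conjTranspose_eq_transpose_of_trivial]
  exact G.isSymm_adjMatrix

/-- The entries are natural numbers, so p ≤ p², and each row sums to U_i(k). -/
lemma sum_chebMat_mul_self_ge {k : ℕ} (hreg : G.IsRegularOfDegree k) (i : ℕ) :
    (Fintype.card V : ℝ) * (chebU ((k : ℝ) - 1) i).eval (k : ℝ) ≤
      ∑ u, ∑ v, chebMat G ((k : ℝ) - 1) i u v * chebMat G ((k : ℝ) - 1) i u v := by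
  have : ∀ u : V, (chebU ((k : ℝ) - 1) i).eval (k : ℝ) = ∑ v, chebMat G ((k : ℝ) - 1) i u v :=
    fun u => ((G.adjMatrix ℝ).aeval_mulVec_const (sum_adjMatrix hreg) _ u).symm
  rw [← nsmul_eq_mul, ← Finset.card_univ, ← Finset.sum_const]
  refine Finset.sum_le_sum fun u _ => ?_
  rw [this u]
  refine Finset.sum_le_sum fun v _ => ?_
  obtain ⟨p, hp⟩ := exists_nat_chebMat hreg i u v
  rw [hp]
  exact_mod_cast Nat.le_mul_self p

/-- The roots of the characteristic polynomial of a bipartite graph are symmetric about `0`. -/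
lemma roots_charpoly_adjMatrix_neg (col : G.Coloring Bool) :
    (G.adjMatrix ℝ).charpoly.roots.map (fun x => -x) = (G.adjMatrix ℝ).charpoly.roots := by
  -- Conjugation by the signs of the two colour classes sends A to -A.
  set S : Matrix V V ℝ := Matrix.diagonal fun v => if col v then 1 else -1 with hS
  have hSS : S * S = 1 := by
    rw [hS, Matrix.diagonal_mul_diagonal, ← Matrix.diagonal_one]
    congr 1; ext v; split_ifs <;> norm_num
  have hconj : S * (G.adjMatrix ℝ * S) = -G.adjMatrix ℝ := by
    ext u v
    rw [hS, Matrix.diagonal_mul, Matrix.mul_diagonal, Matrix.neg_apply, SimpleGraph.adjMatrix_apply]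
    by_cases h : G.Adj u v
    · have := col.valid h
      cases hu : col u <;> cases hv : col v <;> simp_all
    · simp [h]
  rw [← Matrix.roots_charpoly_neg, ← hconj, Matrix.charpoly_mul_comm, Matrix.mul_assoc, hSS,
    Matrix.mul_one]

lemma mem_roots_charpoly_adjMatrix [Nonempty V] {k : ℕ} (hreg : G.IsRegularOfDegree k) :
    (k : ℝ) ∈ (G.adjMatrix ℝ).charpoly.roots := by
  rw [mem_roots (Matrix.charpoly_monic _).ne_zero, IsRoot.def, Matrix.eval_charpoly,
    ← Matrix.exists_mulVec_eq_zero_iff]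
  refine ⟨fun _ => 1, ?_, ?_⟩
  · intro h
    have := congrFun h (Classical.arbitrary V)
    simp at this
  · ext u
    have := sum_adjMatrix hreg u
    rw [Matrix.sub_mulVec, Pi.sub_apply, Pi.zero_apply, sub_eq_zero]
    simp only [Matrix.mulVec, dotProduct, mul_one, this, Matrix.scalar_apply]
    simp [Matrix.diagonal_apply]

end Walks

/-! ### The linear programming bound and its equality case -/

lemma Multiset.sum_map_nonpos {ι : Type*} (s : Multiset ι) (f : ι → ℝ) (h : ∀ x ∈ s, f x ≤ 0) :
    (s.map f).sum ≤ 0 := by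
  simpa using Multiset.sum_map_le_sum_map f (fun _ => 0) h

section Bound

variable {V : Type*} [Fintype V] [DecidableEq V] {G : SimpleGraph V} [DecidableRel G.Adj]

/-- The spectrum of a bipartite regular graph whose second largest eigenvalue is at most `θ`. -/
lemma exists_roots_charpoly_adjMatrix_eq [Nonempty V] {k : ℕ} (hk : 1 ≤ k)
    (hreg : G.IsRegularOfDegree k) (col : G.Coloring Bool) {μ θ : ℝ}
    (hμ : IsSecondLargestEigenvalue (G.adjMatrix ℝ) μ) (hμθ : μ ≤ θ) (hθ : θ < k) :
    ∃ R : Multiset ℝ, (G.adjMatrix ℝ).charpoly.roots = (k : ℝ) ::ₘ (-(k : ℝ)) ::ₘ R ∧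
      ∀ x ∈ R, |x| ≤ θ := by
  have hk' : (1 : ℝ) ≤ k := by exact_mod_cast hk
  have hneg := roots_charpoly_adjMatrix_neg col
  have hmem := mem_roots_charpoly_adjMatrix hreg
  obtain ⟨κ, hκ, hmax, -, hle⟩ := hμ
  set S := (G.adjMatrix ℝ).charpoly.roots with hS
  -- Otherwise k would survive the removal of κ and be at most μ ≤ θ < k.
  have hκk : κ = k := by
    by_contra hne
    have := hle k ((Multiset.mem_erase_of_ne (Ne.symm hne)).2 hmem)
    linarith
  subst hκk
  have hmem' : -(k : ℝ) ∈ S.erase k := by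
    refine (Multiset.mem_erase_of_ne (by linarith)).2 ?_
    rw [← hneg]
    exact Multiset.mem_map_of_mem _ hmem
  have hSeq : S = (k : ℝ) ::ₘ (-(k : ℝ)) ::ₘ (S.erase k).erase (-k) := by
    rw [Multiset.cons_erase hmem', Multiset.cons_erase hmem]
  refine ⟨_, hSeq, ?_⟩
  set R := (S.erase (k : ℝ)).erase (-k) with hR
  -- Removing k and -k together keeps the spectrum symmetric, so the upper bound θ is also a bound
  -- on absolute values.
  have hRneg : R.map (fun x => -x) = R := by
    rw [hSeq, Multiset.map_cons, Multiset.map_cons, neg_neg, Multiset.cons_swap,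
      Multiset.cons_inj_right, Multiset.cons_inj_right] at hneg
    exact hneg
  have hup : ∀ x ∈ R, x ≤ θ := fun x hx => (hle x (Multiset.mem_of_mem_erase hx)).trans hμθ
  intro x hx
  refine abs_le.2 ⟨?_, hup x hx⟩
  have : -x ∈ R := by
    rw [← hRneg]; exact Multiset.mem_map_of_mem _ hx
  linarith [hup _ this]

lemma sum_aeval_mul_aeval {k : ℕ} {R : Multiset ℝ}
    (hR : (G.adjMatrix ℝ).charpoly.roots = (k : ℝ) ::ₘ (-(k : ℝ)) ::ₘ R) (p r : ℝ[X]) :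
    ∑ u, ∑ v, aeval (G.adjMatrix ℝ) p u v * aeval (G.adjMatrix ℝ) r u v =
      p.eval (k : ℝ) * r.eval (k : ℝ) + p.eval (-(k : ℝ)) * r.eval (-(k : ℝ)) +
        (R.map fun x => p.eval x * r.eval x).sum := by
  rw [← G.isSymm_adjMatrix.trace_aeval_mul, adjMatrix_isHermitian.trace_aeval, hR]
  simp [add_assoc]

/-- The linear programming bound for bipartite regular graphs, with its equality conditions. -/
theorem card_mul_le_of_cofactor {k m : ℕ} {c θ : ℝ} (hk : 2 ≤ k) (hc : 0 < c)
    (hreg : G.IsRegularOfDegree k) {R : Multiset ℝ}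
    (hR : (G.adjMatrix ℝ).charpoly.roots = (k : ℝ) ::ₘ (-(k : ℝ)) ::ₘ R)
    (hRθ : ∀ x ∈ R, |x| ≤ θ) {w : ℕ → ℝ} (hw0 : 0 < w 0) (hw : ∀ l, 0 ≤ w l)
    (hcof : ∀ x, (x ^ 2 - θ ^ 2) *
        ∑ l ∈ Finset.range (m / 2 + 1), w l * (chebU (k - 1) (m - 2 * l)).eval x =
          (quotPoly (k - 1) c m).eval x) :
    (Fintype.card V : ℝ) * c ≤ 2 * (quotPoly (k - 1) c m).eval (k : ℝ) ∧
    ((Fintype.card V : ℝ) * c = 2 * (quotPoly (k - 1) c m).eval (k : ℝ) →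
      (∀ x ∈ R, (quotPoly (k - 1) c m).eval x = 0) ∧
      (∀ u v, chebMat G (k - 1) m u v = 0 ∨ chebMat G (k - 1) m u v = 1) ∧
      ∀ u v, nbMat G (k - 1) (m + 2) u v * chebMat G (k - 1) m u v = 0) := by
  have hk' : (2 : ℝ) ≤ k := by exact_mod_cast hk
  set n : ℝ := (Fintype.card V : ℝ)
  set g := quotPoly ((k : ℝ) - 1) c m with hg
  set h : ℝ[X] := ∑ l ∈ Finset.range (m / 2 + 1), C (w l) * chebU (k - 1) (m - 2 * l) with hh
  have heval : ∀ x, h.eval x =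
      ∑ l ∈ Finset.range (m / 2 + 1), w l * (chebU (k - 1) (m - 2 * l)).eval x := by
    intro x; simp [hh, eval_finsetSum]
  simp only [← heval] at hcof
  have hUk : ∀ j, 0 < (chebU ((k : ℝ) - 1) j).eval (k : ℝ) := fun j =>
    (chebU_eval_pos (by linarith) (by linarith) j).1
  have hhk : 0 < h.eval (k : ℝ) := by
    rw [heval, Finset.sum_range_succ']
    refine add_pos_of_nonneg_of_pos
      (Finset.sum_nonneg fun l _ => mul_nonneg (hw _) (hUk _).le) (mul_pos hw0 (hUk _))
  -- g and h have the same parity, so -k contributes to the trace exactly what k does.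
  have hhneg : h.eval (-(k : ℝ)) = (-1) ^ m * h.eval (k : ℝ) := by
    rw [heval, heval, Finset.mul_sum]
    refine Finset.sum_congr rfl fun l hl => ?_
    have hl' : 2 * l ≤ m := by rw [Finset.mem_range] at hl; omega
    have : (-1 : ℝ) ^ m = (-1) ^ (m - 2 * l) := by
      conv_lhs => rw [← Nat.sub_add_cancel hl', pow_add, pow_mul]
      simp
    rw [chebU_eval_neg, this]; ring
  have hsq : ((-1 : ℝ) ^ m) * (-1) ^ m = 1 := by rw [← pow_add, ← two_mul, pow_mul]; simp
  have hspec := sum_aeval_mul_aeval hR g h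
  rw [hhneg, hg, quotPoly_eval_neg, ← hg,
    show (-1) ^ m * g.eval (k : ℝ) * ((-1) ^ m * h.eval (k : ℝ)) =
      ((-1) ^ m * (-1) ^ m) * (g.eval (k : ℝ) * h.eval (k : ℝ)) by ring, hsq, one_mul] at hspec
  have hRle : ∀ x ∈ R, g.eval x * h.eval x ≤ 0 := by
    intro x hx
    have h1 : x ^ 2 ≤ θ ^ 2 := sq_le_sq' (by linarith [(abs_le.1 (hRθ x hx)).1])
      (abs_le.1 (hRθ x hx)).2
    rw [← hcof]
    nlinarith [sq_nonneg (h.eval x)]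
  have hRsum : (R.map fun x => g.eval x * h.eval x).sum ≤ 0 :=
    Multiset.sum_map_nonpos _ _ hRle
  set SF : ℕ → ℝ := fun l =>
    ∑ u, ∑ v, nbMat G (k - 1) (m + 2) u v * chebMat G (k - 1) (m - 2 * l) u v with hSF
  set SU : ℕ → ℝ := fun l =>
    ∑ u, ∑ v, chebMat G (k - 1) m u v * chebMat G (k - 1) (m - 2 * l) u v with hSU
  have hsplit : ∑ u, ∑ v, aeval (G.adjMatrix ℝ) g u v * aeval (G.adjMatrix ℝ) h u v =
      ∑ l ∈ Finset.range (m / 2 + 1), w l * (SF l + c * SU l) := by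
    have e1 : ∀ u v, aeval (G.adjMatrix ℝ) g u v =
        nbMat G (k - 1) (m + 2) u v + c * chebMat G (k - 1) m u v := by
      intro u v
      rw [hg, quotPoly, map_add, map_mul, aeval_C, Algebra.algebraMap_eq_smul_one, smul_one_mul]
      rfl
    have e2 : ∀ u v, aeval (G.adjMatrix ℝ) h u v =
        ∑ l ∈ Finset.range (m / 2 + 1), w l * chebMat G (k - 1) (m - 2 * l) u v := by
      intro u v
      rw [hh, map_sum, Matrix.sum_apply]
      refine Finset.sum_congr rfl fun l _ => ?_
      rw [map_mul, aeval_C, Algebra.algebraMap_eq_smul_one, smul_one_mul]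
      rfl
    simp only [e1, e2, Finset.mul_sum, hSF, hSU, ← Finset.sum_add_distrib]
    rw [Finset.sum_comm' (t' := Finset.univ) (s' := fun _ => Finset.univ) (by simp)]
    simp only [Finset.sum_comm (s := Finset.univ) (t := Finset.range (m / 2 + 1))]
    refine Finset.sum_congr rfl fun l _ => ?_
    rw [Finset.sum_comm]
    refine Finset.sum_congr rfl fun u _ => Finset.sum_congr rfl fun v _ => by ring
  have hSF0 : ∀ l, 0 ≤ SF l := fun l => Finset.sum_nonneg fun u _ => Finset.sum_nonneg fun v _ =>
    mul_nonneg (nbMat_nonneg hreg _ _ _) (chebMat_nonneg hreg _ _ _)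
  -- U_m(A) dominates U_{m-2l}(A) entrywise, so the inner product is at least the squared norm of
  -- the latter.
  have hSU0 : ∀ l ∈ Finset.range (m / 2 + 1),
      n * (chebU ((k : ℝ) - 1) (m - 2 * l)).eval (k : ℝ) ≤ SU l := by
    intro l hl
    rw [Finset.mem_range] at hl
    refine (sum_chebMat_mul_self_ge hreg _).trans ?_
    refine Finset.sum_le_sum fun u _ => Finset.sum_le_sum fun v _ => ?_
    exact mul_le_mul_of_nonneg_right (chebMat_sub_le hreg m l (by omega) u v)
      (chebMat_nonneg hreg _ _ _)
  have hterm : ∀ l ∈ Finset.range (m / 2 + 1),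
      w l * (c * (n * (chebU ((k : ℝ) - 1) (m - 2 * l)).eval (k : ℝ))) ≤
        w l * (SF l + c * SU l) := by
    intro l hl
    refine mul_le_mul_of_nonneg_left ?_ (hw l)
    have := mul_le_mul_of_nonneg_left (hSU0 l hl) hc.le
    linarith [hSF0 l]
  have hlow : ∑ l ∈ Finset.range (m / 2 + 1),
      w l * (c * (n * (chebU ((k : ℝ) - 1) (m - 2 * l)).eval (k : ℝ))) =
        n * c * h.eval (k : ℝ) := by
    rw [heval, Finset.mul_sum]
    exact Finset.sum_congr rfl fun l _ => by ring
  have hle := Finset.sum_le_sum hterm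
  rw [hlow, ← hsplit, hspec] at hle
  refine ⟨le_of_mul_le_mul_right (by linarith) hhk, fun heq => ?_⟩
  rw [heq] at hle
  have hRsum0 : (R.map fun x => g.eval x * h.eval x).sum = 0 := le_antisymm hRsum (by linarith)
  have heqsum : ∑ l ∈ Finset.range (m / 2 + 1),
      w l * (c * (n * (chebU ((k : ℝ) - 1) (m - 2 * l)).eval (k : ℝ))) =
      ∑ l ∈ Finset.range (m / 2 + 1), w l * (SF l + c * SU l) := by
    rw [hlow, ← hsplit, hspec, hRsum0, heq]; ring
  have h0mem : 0 ∈ Finset.range (m / 2 + 1) := by simp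
  -- Equality holds in every term, but only l = 0 is known to have positive weight; that term
  -- already gives all the entrywise information.
  have h0 := mul_left_cancel₀ hw0.ne' ((Finset.sum_eq_sum_iff_of_le hterm).1 heqsum 0 h0mem)
  have h0' := mul_le_mul_of_nonneg_left (hSU0 0 h0mem) hc.le
  have hSFz : SF 0 = 0 := le_antisymm (by linarith) (hSF0 0)
  have hSUz : SU 0 = n * (chebU ((k : ℝ) - 1) m).eval (k : ℝ) := by
    rw [hSFz, zero_add] at h0
    exact (mul_left_cancel₀ hc.ne' h0).symm
  refine ⟨fun x hx => ?_, fun u v => ?_, fun u v => ?_⟩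
  · have hz : g.eval x * h.eval x = 0 := by
      refine le_antisymm (hRle x hx) ?_
      obtain ⟨R', rfl⟩ := Multiset.exists_cons_of_mem hx
      rw [Multiset.map_cons, Multiset.sum_cons] at hRsum0
      have : (R'.map fun x => g.eval x * h.eval x).sum ≤ 0 :=
        Multiset.sum_map_nonpos _ _ fun z hz => hRle z (Multiset.mem_cons_of_mem hz)
      linarith
    -- A root of h is also a root of g = (X² - θ²)h.
    rcases mul_eq_zero.1 hz with h1 | h1
    · exact h1
    · rw [← hcof, h1, mul_zero]
  · have hrow : ∀ u : V, (chebU ((k : ℝ) - 1) m).eval (k : ℝ) = ∑ v, chebMat G ((k : ℝ) - 1) m u v :=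
      fun u => ((G.adjMatrix ℝ).aeval_mulVec_const (sum_adjMatrix hreg) _ u).symm
    have hnn : ∀ u v, 0 ≤ chebMat G ((k : ℝ) - 1) m u v * chebMat G ((k : ℝ) - 1) m u v -
        chebMat G ((k : ℝ) - 1) m u v := by
      intro u v
      obtain ⟨p, hp⟩ := exists_nat_chebMat hreg m u v
      rw [hp, sub_nonneg]
      exact_mod_cast Nat.le_mul_self p
    have hsum : ∑ u, ∑ v, (chebMat G ((k : ℝ) - 1) m u v * chebMat G ((k : ℝ) - 1) m u v -
        chebMat G ((k : ℝ) - 1) m u v) = 0 := by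
      simp only [Finset.sum_sub_distrib, ← hrow]
      rw [Finset.sum_const, Finset.card_univ, nsmul_eq_mul, sub_eq_zero]
      -- The squared entries and the entries of U_m(A) have the same total. Natural numbers with Σp²
      -- = Σp are all 0 or 1.
      simpa [hSU] using hSUz
    have h1 := (Finset.sum_eq_zero_iff_of_nonneg fun u _ =>
      Finset.sum_nonneg fun v _ => hnn u v).1 hsum u (Finset.mem_univ u)
    have h2 := (Finset.sum_eq_zero_iff_of_nonneg fun v _ => hnn u v).1 h1 v (Finset.mem_univ v)
    have h3 : chebMat G ((k : ℝ) - 1) m u v * (chebMat G ((k : ℝ) - 1) m u v - 1) = 0 := by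
      linarith
    rcases mul_eq_zero.1 h3 with h4 | h4
    · exact Or.inl h4
    · exact Or.inr (by linarith)
  · have hnn : ∀ u v, 0 ≤ nbMat G ((k : ℝ) - 1) (m + 2) u v * chebMat G ((k : ℝ) - 1) m u v :=
      fun u v => mul_nonneg (nbMat_nonneg hreg _ _ _) (chebMat_nonneg hreg _ _ _)
    have h1 := (Finset.sum_eq_zero_iff_of_nonneg fun u _ =>
      Finset.sum_nonneg fun v _ => hnn u v).1 (by simpa [hSF] using hSFz) u (Finset.mem_univ u)
    exact (Finset.sum_eq_zero_iff_of_nonneg fun v _ => hnn u v).1 h1 v (Finset.mem_univ v)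

/-- The sign of a vertex in a two-colouring. -/
def colSign (col : G.Coloring Bool) (v : V) : ℝ := if col v then 1 else -1

omit [Fintype V] [DecidableEq V] [DecidableRel G.Adj] in
lemma colSign_mul_self (col : G.Coloring Bool) (v : V) : colSign col v * colSign col v = 1 := by
  unfold colSign; split_ifs <;> norm_num

omit [Fintype V] [DecidableEq V] [DecidableRel G.Adj] in
lemma colSign_adj (col : G.Coloring Bool) {u v : V} (h : G.Adj u v) :
    colSign col v = -colSign col u := by
  have := col.valid h
  unfold colSign
  cases hu : col u <;> cases hv : col v <;> simp_all

omit [Fintype V] [DecidableEq V] [DecidableRel G.Adj] in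
lemma colSign_walk (col : G.Coloring Bool) {u v : V} (p : G.Walk u v) :
    colSign col u * colSign col v = (-1) ^ p.length := by
  induction p with
  | nil => simp [colSign_mul_self]
  | cons h p ih =>
    rw [colSign_adj col h, neg_mul, neg_eq_iff_eq_neg] at ih
    rw [ih, SimpleGraph.Walk.length_cons, pow_succ]; ring

omit [DecidableEq V] in
-- Summing the sign of one endpoint over all ordered adjacent pairs gives k times the total sign;
-- using the other endpoint negates it.
lemma sum_colSign {k : ℕ} (hk : 1 ≤ k) (hreg : G.IsRegularOfDegree k) (col : G.Coloring Bool) :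
    ∑ v, colSign col v = 0 := by
  classical
  have h1 : ∑ u, ∑ v, G.adjMatrix ℝ u v * colSign col u = k * ∑ v, colSign col v := by
    simp only [← Finset.sum_mul, sum_adjMatrix hreg, Finset.mul_sum]
  have h2 : ∑ u, ∑ v, G.adjMatrix ℝ u v * colSign col u = -(k * ∑ v, colSign col v) := by
    suffices h3 : ∑ v, ∑ u, G.adjMatrix ℝ u v * colSign col u =
        -∑ v, ∑ u, G.adjMatrix ℝ v u * colSign col v by
      rw [Finset.sum_comm, h3, h1]
    rw [← Finset.sum_neg_distrib]
    refine Finset.sum_congr rfl fun v _ => ?_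
    rw [← Finset.sum_neg_distrib]
    refine Finset.sum_congr rfl fun u _ => ?_
    rw [SimpleGraph.adjMatrix_apply, SimpleGraph.adjMatrix_apply]
    by_cases h : G.Adj u v
    · rw [if_pos h, if_pos h.symm, colSign_adj col h]; ring
    · rw [if_neg h, if_neg fun h' => h h'.symm]; ring
  have hk' : (1 : ℝ) ≤ k := by exact_mod_cast hk
  have : (k : ℝ) * ∑ v, colSign col v = 0 := by linarith
  exact (mul_eq_zero.1 this).resolve_left (by linarith)

/-- The indicator of pairs of vertices joined by walks of the parity of `m`. -/
noncomputable def parityInd (col : G.Coloring Bool) (m : ℕ) (u v : V) : ℝ :=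
  (1 + (-1) ^ m * (colSign col u * colSign col v)) / 2

omit [Fintype V] [DecidableEq V] [DecidableRel G.Adj] in
lemma parityInd_walk (col : G.Coloring Bool) {u v : V} (p : G.Walk u v) (m : ℕ) :
    parityInd col m u v = if Even (p.length + m) then 1 else 0 := by
  rw [parityInd, colSign_walk col p, ← pow_add, add_comm m]
  split_ifs with h
  · rw [h.neg_one_pow]; norm_num
  · rw [(Nat.not_even_iff_odd.1 h).neg_one_pow]; norm_num

omit [Fintype V] [DecidableEq V] [DecidableRel G.Adj] in
lemma parityInd_mul_self (col : G.Coloring Bool) (m : ℕ) (u v : V) :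
    parityInd col m u v * parityInd col m u v = parityInd col m u v := by
  have h1 := colSign_mul_self col u
  have h2 := colSign_mul_self col v
  have h3 : ((-1 : ℝ) ^ m) * (-1) ^ m = 1 := by rw [← pow_add, ← two_mul, pow_mul]; simp
  have : ((-1) ^ m * (colSign col u * colSign col v)) *
      ((-1) ^ m * (colSign col u * colSign col v)) = 1 := by
    calc _ = ((-1 : ℝ) ^ m * (-1) ^ m) * (colSign col u * colSign col u) *
          (colSign col v * colSign col v) := by ring
      _ = 1 := by rw [h1, h2, h3]; norm_num
  unfold parityInd
  linear_combination this / 4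

omit [DecidableEq V] in
lemma sum_parityInd_row {k : ℕ} (hk : 1 ≤ k) (hreg : G.IsRegularOfDegree k)
    (col : G.Coloring Bool) (m : ℕ) (u : V) :
    ∑ v, parityInd col m u v = Fintype.card V / 2 := by
  simp only [parityInd, ← Finset.sum_div, Finset.sum_add_distrib, ← Finset.mul_sum,
    sum_colSign hk hreg col]
  simp

lemma aeval_quotPoly_apply (q c : ℝ) (m : ℕ) (u v : V) :
    aeval (G.adjMatrix ℝ) (quotPoly q c m) u v =
      nbMat G q (m + 2) u v + c * chebMat G q m u v := by
  rw [quotPoly, map_add, map_mul, aeval_C, Algebra.algebraMap_eq_smul_one, smul_one_mul]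
  rfl

lemma parityInd_eq_one_of_chebMat_ne_zero {k : ℕ} (hreg : G.IsRegularOfDegree k)
    (col : G.Coloring Bool) {m : ℕ} {u v : V} (h : chebMat G ((k : ℝ) - 1) m u v ≠ 0) :
    parityInd col m u v = 1 := by
  induction m using Nat.twoStepInduction with
  | zero =>
    obtain ⟨p, hp⟩ := exists_walk_of_nbMat_ne_zero hreg (i := 0) (u := u) (v := v)
      (by rwa [nbMat_zero, ← chebMat_zero (G := G) ((k : ℝ) - 1)])
    rw [parityInd_walk col p, if_pos (by rw [hp]; decide)]
  | one =>
    obtain ⟨p, hp⟩ := exists_walk_of_nbMat_ne_zero hreg (i := 1) (u := u) (v := v)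
      (by rwa [nbMat_one, ← chebMat_one (G := G) ((k : ℝ) - 1)])
    rw [parityInd_walk col p, if_pos (by rw [hp]; decide)]
  | more m ih _ =>
    have hp2 : parityInd col (m + 2) u v = parityInd col m u v := by
      simp [parityInd, pow_add]
    by_cases h0 : chebMat G ((k : ℝ) - 1) m u v = 0
    · rw [chebMat_add_two, Matrix.add_apply, h0, zero_add] at h
      obtain ⟨p, hp⟩ := exists_walk_of_nbMat_ne_zero hreg h
      rw [parityInd_walk col p, if_pos (by rw [hp]; exact ⟨_, rfl⟩)]
    · rw [hp2]; exact ih h0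

/-- If the remaining eigenvalues are roots of `quotPoly` and the order is extremal, then
`quotPoly` of the adjacency matrix is a multiple of the parity indicator. -/
theorem aeval_quotPoly_eq_of_card_eq {k m : ℕ} {c : ℝ} (hk : 2 ≤ k)
    (hreg : G.IsRegularOfDegree k) (col : G.Coloring Bool) {R : Multiset ℝ}
    (hR : (G.adjMatrix ℝ).charpoly.roots = (k : ℝ) ::ₘ (-(k : ℝ)) ::ₘ R)
    (hR0 : ∀ x ∈ R, (quotPoly (k - 1) c m).eval x = 0)
    (hn : Fintype.card V * c = 2 * (quotPoly (k - 1) c m).eval (k : ℝ)) (u v : V) :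
    nbMat G (k - 1) (m + 2) u v + c * chebMat G (k - 1) m u v = c * parityInd col m u v := by
  set g := quotPoly ((k : ℝ) - 1) c m with hg
  set Q := aeval (G.adjMatrix ℝ) g with hQ
  have hQJ : ∀ u v, Q u v * parityInd col m u v = Q u v := by
    intro u v
    rw [hQ, hg, aeval_quotPoly_apply, add_mul, mul_assoc]
    congr 1
    · by_cases h : nbMat G ((k : ℝ) - 1) (m + 2) u v = 0
      · rw [h, zero_mul]
      · obtain ⟨p, hp⟩ := exists_walk_of_nbMat_ne_zero hreg h
        rw [parityInd_walk col p, if_pos (by rw [hp]; exact ⟨m + 1, by ring⟩), mul_one]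
    · by_cases h : chebMat G ((k : ℝ) - 1) m u v = 0
      · rw [h, zero_mul]
      · rw [parityInd_eq_one_of_chebMat_ne_zero hreg col h, mul_one]
  have hsq : ((-1 : ℝ) ^ m) * (-1) ^ m = 1 := by rw [← pow_add, ← two_mul, pow_mul]; simp
  have h1 : ∑ u, ∑ v, Q u v * Q u v = 2 * (g.eval (k : ℝ) * g.eval (k : ℝ)) := by
    rw [hQ, sum_aeval_mul_aeval hR, hg, quotPoly_eval_neg, ← hg,
      Multiset.map_congr rfl (g := fun _ => (0 : ℝ)) (fun x hx => by rw [hR0 x hx, mul_zero])]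
    simp only [Multiset.map_const', Multiset.sum_replicate, smul_zero, add_zero]
    linear_combination (g.eval (k : ℝ) * g.eval (k : ℝ)) * hsq
  have h2 : ∑ u, ∑ v, Q u v = Fintype.card V * g.eval (k : ℝ) := by
    simp only [hQ, (G.adjMatrix ℝ).aeval_mulVec_const (sum_adjMatrix hreg)]
    simp
  have h3 : ∑ u, ∑ v, parityInd col m u v = Fintype.card V * (Fintype.card V / 2) := by
    simp only [sum_parityInd_row (by omega) hreg col]
    simp
  -- With P the parity indicator, Q is supported on P, so ‖Q - cP‖² = 2g(k)² - 2c n g(k) + c²n²/2 =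
  -- 2(g(k) - cn/2)², which is 0 at the extremal order.
  have h4 : ∑ u, ∑ v, (Q u v - c * parityInd col m u v) * (Q u v - c * parityInd col m u v) = 0 := by
    have e : ∀ u v, (Q u v - c * parityInd col m u v) * (Q u v - c * parityInd col m u v) =
        Q u v * Q u v - 2 * c * Q u v + c ^ 2 * parityInd col m u v := by
      intro u v
      linear_combination (-2 * c) * hQJ u v + c ^ 2 * parityInd_mul_self col m u v
    simp only [e, Finset.sum_add_distrib, Finset.sum_sub_distrib, ← Finset.mul_sum, h1, h2, h3]
    linear_combination (-g.eval (k : ℝ) + c * Fintype.card V / 2) * hn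
  have h5 := (Finset.sum_eq_zero_iff_of_nonneg fun u _ =>
      Finset.sum_nonneg fun v _ => mul_self_nonneg _).1 h4 u (Finset.mem_univ u)
  have h6 := (Finset.sum_eq_zero_iff_of_nonneg fun v _ => mul_self_nonneg _).1 h5 v
    (Finset.mem_univ v)
  rw [← aeval_quotPoly_apply]
  exact sub_eq_zero.1 (mul_self_eq_zero.1 h6)

end Bound

/-! ### Distances in bipartite graphs and numbers of neighbours by layer -/

section Distance

variable {V : Type*} {G : SimpleGraph V}

lemma even_length_add_dist (col : G.Coloring Bool) {u v : V} (p : G.Walk u v) :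
    Even (p.length + G.dist u v) := by
  obtain ⟨r, hr⟩ := p.reachable.exists_walk_length_eq_dist
  rw [← hr, Nat.even_add, col.even_length_iff_congr p, col.even_length_iff_congr r]

lemma dist_adj_cases (hcon : G.Connected) (col : G.Coloring Bool) (u : V) {v x : V}
    (h : G.Adj x v) : G.dist u x + 1 = G.dist u v ∨ G.dist u x = G.dist u v + 1 := by
  obtain ⟨r, hr⟩ := hcon.exists_walk_length_eq_dist u v
  have := even_length_add_dist col (r.concat h.symm)
  rw [SimpleGraph.Walk.length_concat, hr] at this
  obtain ⟨a, ha⟩ := this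
  rcases SimpleGraph.Adj.diff_dist_adj (u := u) h.symm with h' | h' | h' <;> omega

lemma exists_adj_dist_eq (hcon : G.Connected) {u v : V} {i : ℕ} (h : G.dist u v = i + 1) :
    ∃ x, G.Adj x v ∧ G.dist u x = i := by
  obtain ⟨r, hr⟩ := hcon.exists_walk_length_eq_dist u v
  have hnil : ¬ r.Nil := by
    intro hn
    have := SimpleGraph.Walk.length_eq_zero_iff.2 hn
    omega
  have hadj := r.adj_penultimate hnil
  refine ⟨_, hadj, ?_⟩
  have h1 := SimpleGraph.dist_le r.dropLast
  have h2 : r.dropLast.length + 1 = r.length := r.length_dropLast_add_one hnil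
  have h3 := hcon.dist_triangle (u := u) (v := r.penultimate) (w := v)
  rw [SimpleGraph.dist_eq_one_iff_adj.2 hadj] at h3
  omega

end Distance

section Array

variable {n : ℕ} {G : SimpleGraph (Fin n)} [DecidableRel G.Adj]

lemma nbrsAtDist_eq_sum (u v : Fin n) (j : ℕ) :
    (nbrsAtDist G u v j : ℝ) =
      ∑ x, if G.Adj x v then (if G.dist u x = j then (1 : ℝ) else 0) else 0 := by
  rw [nbrsAtDist, Finset.card_filter]
  push_cast
  refine Finset.sum_congr rfl fun x _ => ?_
  by_cases h1 : G.Adj x v <;> by_cases h2 : G.dist u x = j <;> simp [h1, h2, G.adj_comm v x]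

omit [DecidableRel G.Adj] in
lemma nbrsAtDist_pos {u v x : Fin n} (h : G.Adj x v) : 0 < nbrsAtDist G u v (G.dist u x) := by
  rw [nbrsAtDist, Finset.card_pos]
  exact ⟨x, by simp [h.symm]⟩

omit [DecidableRel G.Adj] in
lemma exists_of_nbrsAtDist_pos {u v : Fin n} {j : ℕ} (h : 0 < nbrsAtDist G u v j) :
    ∃ x, G.Adj x v ∧ G.dist u x = j := by
  rw [nbrsAtDist, Finset.card_pos] at h
  obtain ⟨x, hx⟩ := h
  simp only [Finset.mem_filter, Finset.mem_univ, true_and] at hx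
  exact ⟨x, hx.1.symm, hx.2⟩

omit [DecidableRel G.Adj] in
lemma nbrsAtDist_eq_zero (hcon : G.Connected) (col : G.Coloring Bool) {u v : Fin n} {j : ℕ}
    (h1 : j + 1 ≠ G.dist u v) (h2 : j ≠ G.dist u v + 1) : nbrsAtDist G u v j = 0 := by
  by_contra h
  obtain ⟨x, hx, rfl⟩ := exists_of_nbrsAtDist_pos (Nat.pos_of_ne_zero h)
  rcases dist_adj_cases hcon col u hx with h | h
  · exact h1 h
  · exact h2 h

lemma sum_adj_one {k : ℕ} (hreg : G.IsRegularOfDegree k) (v : Fin n) :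
    ∑ x, (if G.Adj x v then (1 : ℝ) else 0) = k := by
  rw [← sum_adjMatrix hreg v]
  refine Finset.sum_congr rfl fun x _ => ?_
  simp [SimpleGraph.adjMatrix_apply, G.adj_comm]

lemma nbrsAtDist_self {k : ℕ} (hreg : G.IsRegularOfDegree k) (u : Fin n) :
    (nbrsAtDist G u u 1 : ℝ) = k := by
  rw [nbrsAtDist_eq_sum, ← sum_adj_one hreg u]
  refine Finset.sum_congr rfl fun x _ => ?_
  split_ifs with h1 h2
  · rfl
  · exact absurd (SimpleGraph.dist_eq_one_iff_adj.2 h1.symm) h2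
  · rfl

lemma nbrsAtDist_add {k : ℕ} (hcon : G.Connected) (col : G.Coloring Bool)
    (hreg : G.IsRegularOfDegree k) {u v : Fin n} {i : ℕ} (h : G.dist u v = i + 1) :
    (nbrsAtDist G u v i : ℝ) + nbrsAtDist G u v (i + 2) = k := by
  rw [nbrsAtDist_eq_sum, nbrsAtDist_eq_sum, ← sum_adj_one hreg v, ← Finset.sum_add_distrib]
  refine Finset.sum_congr rfl fun x _ => ?_
  split_ifs with h1 h2 h3 h3
  · omega
  · simp
  · simp
  · have := dist_adj_cases hcon col u h1
    omega
  · simp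

/-! ### From extremal graphs to the intersection array -/

/-- `G` has the intersection numbers `c_i = 1` for `i ≤ m + 1`, `c_{m+2} = c`, `c_{m+3} = k`, and
diameter at most `m + 3`. -/
def HasMooreArray (G : SimpleGraph (Fin n)) (k m : ℕ) (c : ℝ) : Prop :=
  ∀ u v i, G.dist u v = i + 1 → i ≤ m + 2 ∧
    (nbrsAtDist G u v i : ℝ) = if i ≤ m then 1 else if i = m + 1 then c else k

lemma dist_le_of_nbMat_ne_zero {k : ℕ} (hreg : G.IsRegularOfDegree k) {i : ℕ} {u v : Fin n}
    (h : nbMat G ((k : ℝ) - 1) i u v ≠ 0) : G.dist u v ≤ i := by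
  obtain ⟨p, rfl⟩ := exists_walk_of_nbMat_ne_zero hreg h
  exact G.dist_le p

lemma dist_le_of_chebMat_ne_zero {k : ℕ} (hreg : G.IsRegularOfDegree k) {i : ℕ} {u v : Fin n}
    (h : chebMat G ((k : ℝ) - 1) i u v ≠ 0) : G.dist u v ≤ i := by
  induction i using Nat.twoStepInduction with
  | zero =>
    exact dist_le_of_nbMat_ne_zero hreg (by rwa [nbMat_zero, ← chebMat_zero (G := G) ((k : ℝ) - 1)])
  | one =>
    exact dist_le_of_nbMat_ne_zero hreg (by rwa [nbMat_one, ← chebMat_one (G := G) ((k : ℝ) - 1)])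
  | more i ih _ =>
    rw [chebMat_add_two, Matrix.add_apply] at h
    by_cases h0 : chebMat G ((k : ℝ) - 1) i u v = 0
    · rw [h0, zero_add] at h
      exact dist_le_of_nbMat_ne_zero hreg h
    · exact (ih h0).trans (by omega)

/-- At distance exactly `i + 1`, every non-backtracking walk of length `i + 1` is a geodesic. -/
lemma nbMat_succ_of_dist_eq {k : ℕ} (hcon : G.Connected) (hreg : G.IsRegularOfDegree k) {i : ℕ}
    {u v : Fin n} (h : G.dist u v = i + 1) :
    nbMat G ((k : ℝ) - 1) (i + 1) u v = ∑ x, if G.Adj x v then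
      (if G.dist u x = i then nbMat G ((k : ℝ) - 1) i u x else 0) else 0 := by
  rcases i with _ | i
  · have hadj : G.Adj u v := SimpleGraph.dist_eq_one_iff_adj.1 h
    rw [nbMat_one, SimpleGraph.adjMatrix_apply, if_pos hadj, Finset.sum_eq_single u]
    · simp [hadj, nbMat_zero]
    · intro x _ hx
      rw [nbMat_zero, Matrix.one_apply_ne hx.symm]; simp
    · simp
  · have hz : nbMat G ((k : ℝ) - 1) i u v = 0 := by
      by_contra h0
      have := dist_le_of_nbMat_ne_zero hreg h0
      omega
    have hrec : nbMat G ((k : ℝ) - 1) (i + 2) u v =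
        ∑ x, if G.Adj x v then nbMat G ((k : ℝ) - 1) (i + 1) u x else 0 := by
      rcases i with _ | i
      · have : u ≠ v := by rintro rfl; simp at h
        rw [nbMat_two_apply, if_neg this, mul_zero, sub_zero]
      · rw [nbMat_add_three_apply, hz, mul_zero, sub_zero]
    rw [hrec]
    refine Finset.sum_congr rfl fun x _ => ?_
    split_ifs with h1 h2
    · rfl
    · by_contra h0
      have h3 := dist_le_of_nbMat_ne_zero hreg h0
      have h4 := hcon.dist_triangle (u := u) (v := x) (w := v)
      rw [SimpleGraph.dist_eq_one_iff_adj.2 h1] at h4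
      omega
    · rfl

lemma one_le_nbMat_dist {k : ℕ} (hcon : G.Connected) (hreg : G.IsRegularOfDegree k) {i : ℕ}
    {u v : Fin n} (h : G.dist u v = i) : 1 ≤ nbMat G ((k : ℝ) - 1) i u v := by
  induction i generalizing v with
  | zero =>
    rw [hcon.dist_eq_zero_iff] at h
    subst h
    simp [nbMat_zero]
  | succ i ih =>
    obtain ⟨x, hx, hxi⟩ := exists_adj_dist_eq hcon h
    rw [nbMat_succ_of_dist_eq hcon hreg h]
    have hnn : ∀ y, 0 ≤ if G.Adj y v then
        (if G.dist u y = i then nbMat G ((k : ℝ) - 1) i u y else 0) else 0 := by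
      intro y
      split_ifs
      · exact nbMat_nonneg hreg _ _ _
      · rfl
      · rfl
    refine le_trans ?_ (Finset.single_le_sum (fun y _ => hnn y) (Finset.mem_univ x))
    rw [if_pos hx, if_pos hxi]
    exact ih hxi

/-- The extremal graphs of the linear programming bound. -/
theorem hasMooreArray_of_extremal {k m : ℕ} {c : ℝ} (hc : 0 < c) (hcon : G.Connected)
    (col : G.Coloring Bool) (hreg : G.IsRegularOfDegree k)
    (hU : ∀ u v, chebMat G (k - 1) m u v = 0 ∨ chebMat G (k - 1) m u v = 1)
    (hFU : ∀ u v, nbMat G (k - 1) (m + 2) u v * chebMat G (k - 1) m u v = 0)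
    (hG : ∀ u v, nbMat G (k - 1) (m + 2) u v + c * chebMat G (k - 1) m u v =
      c * parityInd col m u v) : HasMooreArray G k m c := by
  have hUle : ∀ u v, chebMat G ((k : ℝ) - 1) m u v ≤ 1 := fun u v => by
    rcases hU u v with h | h <;> rw [h]
    exact zero_le_one
  have hUle' : ∀ l, 2 * l ≤ m → ∀ u v, chebMat G ((k : ℝ) - 1) (m - 2 * l) u v ≤ 1 :=
    fun l hl u v => (chebMat_sub_le hreg m l hl u v).trans (hUle u v)
  -- At a distance i ≤ m of the parity of m, 1 ≤ F_i ≤ U_i ≤ U_m ≤ 1. No room is left for F_{i+2}: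
  -- it is bounded by U_m - U_i for i < m, and has support disjoint from that of U_m for i = m.
  have hF1 : ∀ {i l u v}, i + 2 * l = m → G.dist u v = i →
      nbMat G ((k : ℝ) - 1) i u v = 1 ∧ nbMat G ((k : ℝ) - 1) (i + 2) u v = 0 := by
    intro i l u v hil hd
    have h1 := one_le_nbMat_dist hcon hreg hd
    have h2 := nbMat_le_chebMat hreg i u v
    have h3 := hUle' l (by omega) u v
    rw [show m - 2 * l = i by omega] at h3
    refine ⟨by linarith, ?_⟩
    rcases l with _ | l
    · obtain rfl : i = m := by omega
      have := hFU u v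
      rwa [show chebMat G ((k : ℝ) - 1) i u v = 1 by linarith, mul_one] at this
    · have h4 := hUle' l (by omega) u v
      rw [show m - 2 * l = i + 2 by omega, chebMat_add_two, Matrix.add_apply] at h4
      have := nbMat_nonneg hreg (i + 2) u v
      linarith
  have hcnt1 : ∀ {i u v}, G.dist u v = i + 1 → 1 ≤ (nbrsAtDist G u v i : ℝ) := by
    intro i u v hd
    obtain ⟨x, hx, hxi⟩ := exists_adj_dist_eq hcon hd
    have := nbrsAtDist_pos (u := u) hx
    rw [hxi] at this
    exact_mod_cast this
  have hsame : ∀ {i l u v}, i + 1 + 2 * l = m → G.dist u v = i + 1 →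
      (nbrsAtDist G u v i : ℝ) = 1 := by
    intro i l u v hil hd
    refine le_antisymm ?_ (hcnt1 hd)
    rw [← (hF1 hil hd).1, nbMat_succ_of_dist_eq hcon hreg hd, nbrsAtDist_eq_sum]
    refine Finset.sum_le_sum fun x _ => ?_
    split_ifs with h1 h2
    · exact one_le_nbMat_dist hcon hreg h2
    · rfl
    · rfl
  have hFcount : ∀ {i l u v}, i + 2 * l = m → G.dist u v = i + 1 →
      nbMat G ((k : ℝ) - 1) (i + 1) u v = nbrsAtDist G u v i := by
    intro i l u v hil hd
    rw [nbMat_succ_of_dist_eq hcon hreg hd, nbrsAtDist_eq_sum]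
    refine Finset.sum_congr rfl fun x _ => ?_
    split_ifs with h1 h2
    · exact (hF1 hil h2).1
    · rfl
    · rfl
  -- For distances of the other parity, take a predecessor x of v. F_{i+2} vanishing at (u, x) says
  -- that the walk counts at the neighbours of x total k - 1 times a count equal to 1. The k - 1
  -- neighbours further out already contribute at least 1 each, so each contributes exactly 1.
  have hdiff : ∀ {i l u v}, i + 2 * l = m → G.dist u v = i + 1 →
      nbMat G ((k : ℝ) - 1) (i + 1) u v = 1 := by
    intro i l u v hil hd
    refine le_antisymm ?_ (one_le_nbMat_dist hcon hreg hd)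
    rcases i with _ | i
    · rw [nbMat_one, SimpleGraph.adjMatrix_apply]
      split_ifs <;> norm_num
    · obtain ⟨x, hx, hxi⟩ := exists_adj_dist_eq hcon hd
      obtain ⟨e1, e2⟩ := hF1 hil hxi
      rw [nbMat_add_three_apply, e1, mul_one, sub_eq_zero] at e2
      have e3 := nbrsAtDist_add hcon col hreg hxi
      rw [hsame hil hxi] at e3
      have e4 : (nbrsAtDist G u x (i + 2) : ℝ) =
          ∑ z, if G.Adj z x then nbMat G ((k : ℝ) - 1) (i + 2) u z else 0 := by
        rw [e2]; linarith
      rw [nbrsAtDist_eq_sum] at e4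
      have hterm : ∀ z ∈ Finset.univ,
          (if G.Adj z x then (if G.dist u z = i + 2 then (1 : ℝ) else 0) else 0) ≤
          if G.Adj z x then nbMat G ((k : ℝ) - 1) (i + 2) u z else 0 := by
        intro z _
        split_ifs with h1 h2
        · exact one_le_nbMat_dist hcon hreg h2
        · exact nbMat_nonneg hreg _ _ _
        · rfl
      have := (Finset.sum_eq_sum_iff_of_le hterm).1 e4 v (Finset.mem_univ v)
      rw [if_pos hx.symm, if_pos hx.symm, if_pos hd] at this
      exact this.ge
  -- Beyond distance m + 2 both F_{m+2} and U_m vanish, whereas g(A) is c > 0 on the parity class.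
  have hpar : ∀ {u v}, parityInd col m u v = 1 → G.dist u v ≤ m + 2 := by
    intro u v h
    by_contra! hlt
    have h1 : nbMat G ((k : ℝ) - 1) (m + 2) u v = 0 := by
      by_contra h0
      have := dist_le_of_nbMat_ne_zero hreg h0
      omega
    have h2 : chebMat G ((k : ℝ) - 1) m u v = 0 := by
      by_contra h0
      have := dist_le_of_chebMat_ne_zero hreg h0
      omega
    have := hG u v
    rw [h1, h2, h] at this
    linarith
  have hparD : ∀ u v, parityInd col m u v = if Even (G.dist u v + m) then 1 else 0 := by
    intro u v
    obtain ⟨r, hr⟩ := hcon.exists_walk_length_eq_dist u v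
    rw [parityInd_walk col r, hr]
  have hle : ∀ {u v}, Even (G.dist u v + m) → G.dist u v ≤ m + 2 := fun {u v} h =>
    hpar (by rw [hparD, if_pos h])
  intro u v i hd
  rcases Nat.even_or_odd (i + m) with hev | hodd
  · -- `i` has the parity of `m`
    obtain ⟨x, hx, hxi⟩ := exists_adj_dist_eq hcon hd
    have hi := hle (by rw [hxi]; exact hev)
    rw [hxi] at hi
    refine ⟨hi, ?_⟩
    obtain ⟨a, ha⟩ := hev
    split_ifs with h1 h2
    · have h3 : i + 2 * (m - a) = m := by omega
      rw [← hFcount h3 hd, hdiff h3 hd]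
    · omega
    · obtain rfl : i = m + 2 := by omega
      have h3 := nbrsAtDist_add hcon col hreg hd
      -- Distance m + 4 has the parity of m and exceeds m + 2, so all k neighbours point back.
      have h4 : nbrsAtDist G u v (m + 2 + 2) = 0 := by
        by_contra h0
        obtain ⟨y, hy, hyi⟩ := exists_of_nbrsAtDist_pos (Nat.pos_of_ne_zero h0)
        have := hle (u := u) (v := y) (by rw [hyi]; exact ⟨m + 2, by ring⟩)
        omega
      rw [h4] at h3
      simpa using h3
  · obtain ⟨a, ha⟩ := hodd
    have hi := hle (u := u) (v := v) (by rw [hd]; exact ⟨a + 1, by omega⟩)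
    rw [hd] at hi
    refine ⟨by omega, ?_⟩
    split_ifs with h1 h2
    · exact hsame (l := m - a - 1) (by omega) hd
    · subst h2
      have h2 : chebMat G ((k : ℝ) - 1) m u v = 0 := by
        by_contra h0
        have := dist_le_of_chebMat_ne_zero hreg h0
        omega
      have h3 := hG u v
      rw [h2, hparD, hd, if_pos ⟨m + 1, by ring⟩, mul_zero, add_zero, mul_one] at h3
      -- At distance m + 2, F_{m+2} equals c, and it counts predecessors because each is reached by
      -- a single walk.
      rw [← h3, nbMat_succ_of_dist_eq hcon hreg hd, nbrsAtDist_eq_sum]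
      refine Finset.sum_congr rfl fun x _ => ?_
      split_ifs with h5 h6
      · exact (hdiff (i := m) (l := 0) (by omega) h6).symm
      · rfl
      · rfl
    · omega

/-- F_{m+2}(A) has positive row sums. A nonzero entry at a smaller distance d would have the parity
of m, hence 1 ≤ F_d ≤ U_d ≤ U_m, against disjointness of supports. The pair found makes c an actual
neighbour count, whence 1 ≤ c ≤ k. -/
lemma exists_dist_eq_of_extremal [Nonempty (Fin n)] {k m : ℕ} (hk : 2 ≤ k) (hcon : G.Connected)
    (col : G.Coloring Bool) (hreg : G.IsRegularOfDegree k)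
    (hFU : ∀ u v, nbMat G (k - 1) (m + 2) u v * chebMat G (k - 1) m u v = 0) :
    ∃ u v, G.dist u v = m + 2 := by
  have hk' : (2 : ℝ) ≤ k := by exact_mod_cast hk
  have u : Fin n := Classical.arbitrary _
  have hrow : ∑ v, nbMat G ((k : ℝ) - 1) (m + 2) u v = (nbPoly ((k : ℝ) - 1) (m + 2)).eval (k : ℝ) :=
    (G.adjMatrix ℝ).aeval_mulVec_const (sum_adjMatrix hreg) _ u
  have hpos := nbPoly_eval_pos (q := (k : ℝ) - 1) (x := k) (by linarith) (by linarith) m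
  rw [← hrow] at hpos
  obtain ⟨v, -, hv⟩ := Finset.exists_ne_zero_of_sum_ne_zero hpos.ne'
  refine ⟨u, v, ?_⟩
  have h1 := dist_le_of_nbMat_ne_zero hreg hv
  by_contra hne
  obtain ⟨p, hp⟩ := exists_walk_of_nbMat_ne_zero hreg hv
  obtain ⟨a, ha⟩ := even_length_add_dist col p
  have hU := (mul_eq_zero.1 (hFU u v)).resolve_left hv
  have h2 := chebMat_sub_le hreg m (m + 1 - a) (by omega) u v
  rw [show m - 2 * (m + 1 - a) = G.dist u v by omega, hU] at h2
  have h3 := nbMat_le_chebMat hreg (G.dist u v) u v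
  have h4 := one_le_nbMat_dist hcon hreg (u := u) (v := v) rfl
  linarith

end Array

/-! ### From the intersection array to order and spectrum -/

section Converse

variable {n : ℕ} {G : SimpleGraph (Fin n)} [DecidableRel G.Adj]

lemma sum_ite_adj_ite_dist (u v : Fin n) (j : ℕ) (a : ℝ) :
    (∑ x, if G.Adj x v then (if G.dist u x = j then a else 0) else 0) =
      a * nbrsAtDist G u v j := by
  rw [nbrsAtDist_eq_sum, Finset.mul_sum]
  refine Finset.sum_congr rfl fun x _ => ?_
  split_ifs <;> simp

/-- F_i(A) is the distance-i matrix, up to the factor c at i = m + 2: in the recurrence, the k - 1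
outward neighbours at distance i - 2 cancel the subtracted q, and distance i contributes the
intersection number. -/
lemma HasMooreArray.nbMat_eq {k m : ℕ} {c : ℝ} (h : HasMooreArray G k m c) (hcon : G.Connected)
    (col : G.Coloring Bool) (hreg : G.IsRegularOfDegree k) {i : ℕ} (hi : i ≤ m + 2)
    (u v : Fin n) :
    nbMat G ((k : ℝ) - 1) i u v =
      if G.dist u v = i then (if i ≤ m + 1 then 1 else c) else 0 := by
  induction i using Nat.strong_induction_on generalizing v with
  | _ i ih =>
  match i with
  | 0 => simp [nbMat_zero, Matrix.one_apply, hcon.dist_eq_zero_iff]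
  | 1 => simp [nbMat_one, SimpleGraph.adjMatrix_apply]
  | 2 =>
    rw [nbMat_two_apply]
    simp only [ih 1 (by omega) (by omega), if_pos (show 1 ≤ m + 1 by omega),
      sum_ite_adj_ite_dist, one_mul, sub_add_cancel]
    by_cases h0 : u = v
    · subst h0
      rw [nbrsAtDist_self hreg]
      simp
    · rw [if_neg h0, mul_zero, sub_zero]
      have h0' : G.dist u v ≠ 0 := by rwa [Ne, hcon.dist_eq_zero_iff]
      by_cases h2 : G.dist u v = 2
      · rw [if_pos h2, (h u v 1 h2).2]
        split_ifs <;> first | rfl | omega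
      · rw [if_neg h2, nbrsAtDist_eq_zero hcon col (by omega) (by omega), Nat.cast_zero]
  | i + 3 =>
    rw [nbMat_add_three_apply]
    simp only [ih (i + 2) (by omega) (by omega), ih (i + 1) (by omega) (by omega),
      if_pos (show i + 2 ≤ m + 1 by omega), if_pos (show i + 1 ≤ m + 1 by omega),
      sum_ite_adj_ite_dist, one_mul]
    by_cases h1 : G.dist u v = i + 1
    · have h3 := nbrsAtDist_add hcon col hreg h1
      have h4 := (h u v i h1).2
      rw [if_pos (by omega)] at h4
      rw [if_pos h1, if_neg (by omega)]
      linarith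
    · rw [if_neg h1, mul_zero, sub_zero]
      by_cases h2 : G.dist u v = i + 3
      · rw [if_pos h2, (h u v (i + 2) h2).2]
        split_ifs <;> first | rfl | omega
      · rw [if_neg h2, nbrsAtDist_eq_zero hcon col (by omega) (by omega), Nat.cast_zero]

lemma HasMooreArray.chebMat_eq {k m : ℕ} {c : ℝ} (h : HasMooreArray G k m c) (hcon : G.Connected)
    (col : G.Coloring Bool) (hreg : G.IsRegularOfDegree k) {i : ℕ} (hi : i ≤ m + 1)
    (u v : Fin n) :
    chebMat G ((k : ℝ) - 1) i u v =
      if G.dist u v ≤ i ∧ Even (G.dist u v + i) then 1 else 0 := by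
  induction i using Nat.twoStepInduction with
  | zero =>
    rw [chebMat_zero, ← nbMat_zero (G := G) ((k : ℝ) - 1), h.nbMat_eq hcon col hreg (by omega)]
    by_cases h0 : G.dist u v = 0 <;> simp [h0]
  | one =>
    rw [chebMat_one, ← nbMat_one (G := G) ((k : ℝ) - 1), h.nbMat_eq hcon col hreg (by omega)]
    have : (G.dist u v ≤ 1 ∧ Even (G.dist u v + 1)) ↔ G.dist u v = 1 := by
      constructor
      · rintro ⟨h1, a, ha⟩; omega
      · intro h1; rw [h1]; decide
    simp only [this]
    simp
  | more i ih _ =>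
    rw [chebMat_add_two, Matrix.add_apply, ih (by omega), h.nbMat_eq hcon col hreg (by omega),
      if_pos hi]
    have : Even (G.dist u v + (i + 2)) ↔ Even (G.dist u v + i) := by
      simp [← add_assoc, Nat.even_add]
    simp only [this]
    by_cases h2 : G.dist u v = i + 2
    · have : Even (i + 2 + i) := ⟨i + 1, by ring⟩
      simp [h2, this]
    · rw [if_neg h2, add_zero]
      by_cases hev : Even (G.dist u v + i)
      · have : G.dist u v ≤ i + 2 ↔ G.dist u v ≤ i := by
          obtain ⟨a, ha⟩ := hev
          omega
        simp [this]
      · simp [hev]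

/-- c U_m covers the distances up to m of the parity of m, and F_{m+2} supplies the same value c at
m + 2. No distance exceeds m + 3, so the class is exhausted. -/
lemma HasMooreArray.aeval_quotPoly_eq {k m : ℕ} {c : ℝ} (h : HasMooreArray G k m c)
    (hcon : G.Connected) (col : G.Coloring Bool) (hreg : G.IsRegularOfDegree k) (u v : Fin n) :
    aeval (G.adjMatrix ℝ) (quotPoly (k - 1) c m) u v = c * parityInd col m u v := by
  obtain ⟨r, hr⟩ := hcon.exists_walk_length_eq_dist u v
  rw [aeval_quotPoly_apply, parityInd_walk col r, hr, h.nbMat_eq hcon col hreg le_rfl,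
    h.chebMat_eq hcon col hreg (by omega), if_neg (show ¬ m + 2 ≤ m + 1 by omega)]
  have hle : G.dist u v ≤ m + 3 := by
    rcases hd : G.dist u v with _ | i
    · omega
    · have := (h u v i hd).1; omega
  by_cases hev : Even (G.dist u v + m)
  · simp only [hev, and_true, if_true]
    obtain ⟨a, ha⟩ := hev
    by_cases h2 : G.dist u v = m + 2
    · simp [h2]
    · rw [if_neg h2, if_pos (by omega)]; ring
  · have : G.dist u v ≠ m + 2 := by
      intro h2; rw [h2] at hev; exact hev ⟨m + 1, by ring⟩
    simp [hev, this]

/-- A graph with a Moore array has extremal order. -/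
lemma HasMooreArray.card_mul {k m : ℕ} {c : ℝ} (hk : 2 ≤ k) (h : HasMooreArray G k m c)
    (hcon : G.Connected) (col : G.Coloring Bool) (hreg : G.IsRegularOfDegree k) :
    (n : ℝ) * c = 2 * (quotPoly (k - 1) c m).eval (k : ℝ) := by
  obtain ⟨u⟩ := hcon.nonempty
  have h1 := (G.adjMatrix ℝ).aeval_mulVec_const (sum_adjMatrix hreg) (quotPoly (k - 1) c m) u
  simp only [h.aeval_quotPoly_eq hcon col hreg, ← Finset.mul_sum,
    sum_parityInd_row (by omega) hreg col, Fintype.card_fin] at h1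
  linarith

/-- The second largest eigenvalue of a graph with a Moore array. -/
lemma HasMooreArray.exists_isSecondLargestEigenvalue {k m : ℕ} {c θ : ℝ} (hk : 2 ≤ k) (hc : 0 < c)
    (h : HasMooreArray G k m c)
    (hcon : G.Connected) (col : G.Coloring Bool) (hreg : G.IsRegularOfDegree k)
    (hθk : -(k : ℝ) ≤ θ) (hθ : ∀ x, (quotPoly (k - 1) c m).eval x = 0 → x ≤ θ) :
    ∃ μ : ℝ, IsSecondLargestEigenvalue (G.adjMatrix ℝ) μ ∧ μ ≤ θ := by
  have hk' : (2 : ℝ) ≤ k := by exact_mod_cast hk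
  have := hcon.nonempty
  have hmem := mem_roots_charpoly_adjMatrix hreg
  have hneg := roots_charpoly_adjMatrix_neg col
  have hmem' : -(k : ℝ) ∈ (G.adjMatrix ℝ).charpoly.roots.erase (k : ℝ) := by
    refine (Multiset.mem_erase_of_ne (by linarith)).2 ?_
    rw [← hneg]
    exact Multiset.mem_map_of_mem _ hmem
  obtain ⟨R, hR⟩ := Multiset.exists_cons_of_mem hmem'
  have hroots : (G.adjMatrix ℝ).charpoly.roots = (k : ℝ) ::ₘ (-(k : ℝ)) ::ₘ R := by
    rw [← hR, Multiset.cons_erase hmem]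
  set g := quotPoly ((k : ℝ) - 1) c m with hg
  have hcard := h.card_mul hk hcon col hreg
  have hsq : ((-1 : ℝ) ^ m) * (-1) ^ m = 1 := by rw [← pow_add, ← two_mul, pow_mul]; simp
  have htr := sum_aeval_mul_aeval hroots g g
  have htr2 : ∑ u, ∑ v, aeval (G.adjMatrix ℝ) g u v * aeval (G.adjMatrix ℝ) g u v =
      2 * (g.eval (k : ℝ) * g.eval (k : ℝ)) := by
    have e : ∀ u v, aeval (G.adjMatrix ℝ) g u v * aeval (G.adjMatrix ℝ) g u v =
        c ^ 2 * parityInd col m u v := by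
      intro u v
      rw [h.aeval_quotPoly_eq hcon col hreg]
      linear_combination c ^ 2 * parityInd_mul_self col m u v
    simp only [e, ← Finset.mul_sum, sum_parityInd_row (by omega) hreg col]
    simp only [Finset.sum_const, Finset.card_univ, Fintype.card_fin, nsmul_eq_mul]
    linear_combination ((n : ℝ) * c / 2 + g.eval (k : ℝ)) * hcard
  rw [htr2, hg, quotPoly_eval_neg, ← hg] at htr
  -- The squared norm of g(A), computed from its entries, is already accounted for by ±k, so g
  -- vanishes on the rest of the spectrum.
  have hsum : (R.map fun x => g.eval x * g.eval x).sum = 0 := by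
    linear_combination -htr - (g.eval (k : ℝ) * g.eval (k : ℝ)) * hsq
  have hR0 : ∀ x ∈ R, g.eval x = 0 := by
    intro x hx
    obtain ⟨R', rfl⟩ := Multiset.exists_cons_of_mem hx
    rw [Multiset.map_cons, Multiset.sum_cons] at hsum
    have h1 : 0 ≤ (R'.map fun x => g.eval x * g.eval x).sum := by
      refine Multiset.sum_nonneg fun y hy => ?_
      obtain ⟨z, -, rfl⟩ := Multiset.mem_map.1 hy
      exact mul_self_nonneg _
    have h2 := mul_self_nonneg (g.eval x)
    exact mul_self_eq_zero.1 (by linarith)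
  obtain ⟨μ, hμ, hmax⟩ := Finset.exists_max_image (-(k : ℝ) ::ₘ R).toFinset id ⟨-k, by simp⟩
  simp only [Multiset.mem_toFinset, id_eq] at hμ hmax
  refine ⟨μ, ⟨k, hmem, ?_, ?_, ?_⟩, ?_⟩
  · intro ν hν
    rw [hroots, Multiset.mem_cons, Multiset.mem_cons] at hν
    rcases hν with rfl | rfl | hν
    · exact le_rfl
    · linarith
    · have := abs_lt_of_isRoot_quotPoly (by linarith) hc (hR0 ν hν)
      have := le_abs_self ν
      linarith
  · rwa [hR]
  · rwa [hR]
  · rw [Multiset.mem_cons] at hμ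
    rcases hμ with rfl | hμ
    · exact hθk
    · exact hθ μ (hR0 μ hμ)

end Converse

/-! ### Intersection arrays and distance-regular graphs -/

section DistanceRegular

variable {n : ℕ} {G : SimpleGraph (Fin n)}

lemma exists_dist_eq_of_le (hcon : G.Connected) {u v : Fin n} {i : ℕ} (h : i ≤ G.dist u v) :
    ∃ x, G.dist u x = i := by
  obtain ⟨d, hd⟩ := Nat.exists_eq_add_of_le h
  induction d generalizing v with
  | zero => exact ⟨v, by omega⟩
  | succ d ih =>
    obtain ⟨x, -, hx⟩ := exists_adj_dist_eq (i := i + d) hcon (by omega)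
    exact ih (by omega) hx

lemma distLayer_nonempty_iff {u : Fin n} {i : ℕ} :
    (distLayer G u i).Nonempty ↔ ∃ v, G.dist u v = i := by
  simp [distLayer, Finset.Nonempty]

lemma isDistanceRegular_of_nbrsAtDist_eq (hcon : G.Connected) (f : ℕ → ℕ → ℝ)
    (h : ∀ u v j, (nbrsAtDist G u v j : ℝ) = f (G.dist u v) j) : IsDistanceRegular G := by
  refine ⟨hcon, fun i j => ?_⟩
  by_cases hex : ∃ u v, G.dist u v = i
  · obtain ⟨u, v, huv⟩ := hex
    refine ⟨nbrsAtDist G u v j, fun u' v' h' => ?_⟩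
    have := h u' v' j
    rw [h', ← huv, ← h u v j] at this
    exact_mod_cast this
  · exact ⟨0, fun u v huv => absurd ⟨u, v, huv⟩ hex⟩

lemma isDistanceQuotientMatrix_of_nbrsAtDist_eq {s : ℕ} {u : Fin n}
    {Q : Matrix (Fin s) (Fin s) ℝ} (hlayer : ∀ i, (∃ v, G.dist u v = i) ↔ i < s)
    (h : ∀ v, ∀ i j : Fin s, G.dist u v = i → (nbrsAtDist G u v j : ℝ) = Q i j) :
    IsDistanceQuotientMatrix G u Q := by
  refine ⟨fun i => distLayer_nonempty_iff.trans (hlayer i), fun i j => ?_⟩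
  have hne : (distLayer G u i).Nonempty := distLayer_nonempty_iff.2 ((hlayer i).2 i.2)
  have hsum : ∑ v ∈ distLayer G u i, (nbrsAtDist G u v j : ℝ) =
      ∑ v ∈ distLayer G u i, Q i j :=
    Finset.sum_congr rfl fun v hv => h v i j (by simpa [distLayer] using hv)
  have hcard : ((distLayer G u i).card : ℝ) ≠ 0 := by
    exact_mod_cast hne.card_pos.ne'
  rw [hsum, Finset.sum_const, nsmul_eq_mul, mul_div_cancel_left₀ _ hcard]

/-- In a distance-regular graph the quotient matrix gives the numbers of neighbours. -/
lemma IsDistanceQuotientMatrix.nbrsAtDist_eq {s : ℕ} {u : Fin n} {Q : Matrix (Fin s) (Fin s) ℝ}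
    (hQ : IsDistanceQuotientMatrix G u Q) (hG : IsDistanceRegular G) (a v : Fin n) (i j : Fin s)
    (hd : G.dist a v = i) : (nbrsAtDist G a v j : ℝ) = Q i j := by
  obtain ⟨p, hp⟩ := hG.2 i j
  have hne : (distLayer G u i).Nonempty := (hQ.1 i).2 i.2
  have hsum : ∑ v ∈ distLayer G u i, (nbrsAtDist G u v j : ℝ) = ∑ v ∈ distLayer G u i, (p : ℝ) :=
    Finset.sum_congr rfl fun v hv => by rw [hp u v (by simpa [distLayer] using hv)]
  have hcard : ((distLayer G u i).card : ℝ) ≠ 0 := by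
    exact_mod_cast hne.card_pos.ne'
  rw [hQ.2 i j, hsum, Finset.sum_const, nsmul_eq_mul, mul_div_cancel_left₀ _ hcard, hp a v hd]

/-- The number of neighbours at distance `j` of a vertex at distance `i`, in terms of the
numbers `c_i`. -/
def arrayEntry (k : ℕ) (f : ℕ → ℝ) (i j : ℕ) : ℝ :=
  if j + 1 = i then f j else if i + 1 = j then (if i = 0 then (k : ℝ) else k - f (i - 1)) else 0

lemma nbrsAtDist_eq_arrayEntry [DecidableRel G.Adj] {k : ℕ} (hcon : G.Connected)
    (col : G.Coloring Bool) (hreg : G.IsRegularOfDegree k) {f : ℕ → ℝ}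
    (h : ∀ u v i, G.dist u v = i + 1 → (nbrsAtDist G u v i : ℝ) = f i) (u v : Fin n) (j : ℕ) :
    (nbrsAtDist G u v j : ℝ) = arrayEntry k f (G.dist u v) j := by
  unfold arrayEntry
  split_ifs with h1 h2 h3
  · exact h u v j h1.symm
  · rw [hcon.dist_eq_zero_iff] at h3
    subst h3
    obtain rfl : j = 1 := by simpa using h2.symm
    exact nbrsAtDist_self hreg u
  · obtain ⟨i, hi⟩ := Nat.exists_eq_succ_of_ne_zero h3
    have := nbrsAtDist_add hcon col hreg hi
    rw [h u v i hi] at this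
    rw [hi] at h2 ⊢
    subst h2
    simp only [Nat.succ_eq_add_one, Nat.add_sub_cancel] at this ⊢
    linarith
  · rw [nbrsAtDist_eq_zero hcon col h1 (fun h => h2 h.symm), Nat.cast_zero]

/-- While fewer than k neighbours lie closer to u, some neighbour lies further, so the next layer is
nonempty. -/
lemma exists_dist_eq_of_lt [DecidableRel G.Adj] {k : ℕ} (hk : 1 ≤ k) (hcon : G.Connected)
    (col : G.Coloring Bool) (hreg : G.IsRegularOfDegree k) {s : ℕ}
    (h : ∀ u v i, i + 2 < s → G.dist u v = i + 1 → (nbrsAtDist G u v i : ℝ) < k) (u : Fin n)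
    {i : ℕ} (hi : i < s) : ∃ v, G.dist u v = i := by
  match i with
  | 0 => exact ⟨u, by simp⟩
  | 1 =>
    have h1 : 0 < nbrsAtDist G u u 1 := by
      have := nbrsAtDist_self hreg u
      have h2 : nbrsAtDist G u u 1 = k := by exact_mod_cast this
      omega
    obtain ⟨x, -, hx⟩ := exists_of_nbrsAtDist_pos h1
    exact ⟨x, hx⟩
  | i + 2 =>
    obtain ⟨v, hv⟩ := exists_dist_eq_of_lt hk hcon col hreg h u (i := i + 1) (by omega)
    have h1 := nbrsAtDist_add hcon col hreg hv
    have h2 := h u v i hi hv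
    have h3 : 0 < nbrsAtDist G u v (i + 2) := by
      have : (0 : ℝ) < nbrsAtDist G u v (i + 2) := by linarith
      exact_mod_cast this
    obtain ⟨x, -, hx⟩ := exists_of_nbrsAtDist_pos h3
    exact ⟨x, hx⟩

/-- A graph with a Moore array is distance-regular with quotient matrix `B(k, m + 4, c)`, or
`B(k, m + 3, 1)` if `c = k`. -/
theorem HasMooreArray.existsBipartiteDRG [DecidableRel G.Adj] {k m : ℕ} {c : ℝ} (hk : 2 ≤ k)
    (h : HasMooreArray G k m c) (hcon : G.Connected) (hbip : G.IsBipartite)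
    (col : G.Coloring Bool) (hreg : G.IsRegularOfDegree k) :
    (c < k → ExistsBipartiteDRG (tridiagB k (m + 4) c)) ∧
    (c = k → ExistsBipartiteDRG (tridiagB k (m + 3) 1)) := by
  have hk' : (2 : ℝ) ≤ k := by exact_mod_cast hk
  obtain ⟨u⟩ := hcon.nonempty
  have hent := nbrsAtDist_eq_arrayEntry hcon col hreg (fun u v i hd => (h u v i hd).2)
  have hdr := isDistanceRegular_of_nbrsAtDist_eq hcon _ hent
  constructor
  · intro hck
    refine ⟨n, G, hbip, hdr, u, isDistanceQuotientMatrix_of_nbrsAtDist_eq (fun i => ?_) ?_⟩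
    · constructor
      · rintro ⟨v, hv⟩
        rcases i with _ | i
        · omega
        · have := (h u v i hv).1; omega
      · refine exists_dist_eq_of_lt (by omega) hcon col hreg (fun u v i hi hd => ?_) u
        rw [(h u v i hd).2]
        split_ifs
        · linarith
        · exact hck
        · omega
    · intro v i j hd
      rw [hent, hd]
      have hi := i.2
      have hj := j.2
      simp only [arrayEntry, tridiagB, Matrix.of_apply]
      split_ifs <;> first | rfl | omega
  · intro hck
    subst hck
    refine ⟨n, G, hbip, hdr, u, isDistanceQuotientMatrix_of_nbrsAtDist_eq (fun i => ?_) ?_⟩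
    · constructor
      · rintro ⟨v, hv⟩
        -- With c = k, all neighbours of a vertex at distance m + 2 point back, so nothing lies at
        -- distance m + 3.
        by_contra hi
        obtain ⟨x, hx⟩ := exists_dist_eq_of_le (i := m + 3) hcon (u := u) (v := v) (by omega)
        obtain ⟨y, hy, hyd⟩ := exists_adj_dist_eq hcon hx
        have h1 := (h u y (m + 1) hyd).2
        rw [if_neg (by omega), if_pos rfl] at h1
        have h2 := nbrsAtDist_add hcon col hreg hyd
        have h3 := nbrsAtDist_pos (u := u) hy.symm
        rw [hx] at h3
        have h4 : (0 : ℝ) < nbrsAtDist G u y (m + 1 + 2) := by exact_mod_cast h3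
        linarith
      · refine exists_dist_eq_of_lt (by omega) hcon col hreg (fun u v i hi hd => ?_) u
        rw [(h u v i hd).2, if_pos (by omega)]
        linarith
    · intro v i j hd
      rw [hent, hd]
      have hi := i.2
      have hj := j.2
      simp only [arrayEntry, tridiagB, Matrix.of_apply]
      split_ifs <;> first | rfl | omega

/-- The Moore array of a bipartite distance-regular graph with a given tridiagonal quotient. -/
theorem IsDistanceQuotientMatrix.hasMooreArray [DecidableRel G.Adj] {k s m : ℕ} {c c' : ℝ}
    (hs : 3 ≤ s) (hsm : s ≤ m + 4) {u : Fin n} (hG : IsDistanceRegular G)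
    (hbip : G.IsBipartite) (hQ : IsDistanceQuotientMatrix G u (tridiagB k s c'))
    (hlow : ∀ i, i + 1 < s → (if i + 2 = s then (k : ℝ) else if i + 3 = s then c' else 1) =
      if i ≤ m then 1 else if i = m + 1 then c else k) :
    G.IsRegularOfDegree k ∧ HasMooreArray G k m c := by
  have hcon := hG.1
  have col : G.Coloring Bool := hbip.toColoring (by simp)
  have hreg : G.IsRegularOfDegree k := by
    intro v
    have h1 := hQ.nbrsAtDist_eq hG v v ⟨0, by omega⟩ ⟨1, by omega⟩ (by simp)
    simp [tridiagB] at h1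
    have h2 : nbrsAtDist G v v 1 = G.degree v := by
      rw [nbrsAtDist, ← G.card_neighborFinset_eq_degree]
      congr 1
      ext w
      simp
    rw [← h2]
    exact_mod_cast h1
  have hcount : ∀ a v i, i + 1 < s → G.dist a v = i + 1 → (nbrsAtDist G a v i : ℝ) =
      if i + 2 = s then (k : ℝ) else if i + 3 = s then c' else 1 := by
    intro a v i hi hd
    rw [hQ.nbrsAtDist_eq hG a v ⟨i + 1, hi⟩ ⟨i, by omega⟩ hd]
    simp [tridiagB]
  refine ⟨hreg, fun a v i hd => ?_⟩
  -- The quotient matrix bounds distances only from the base vertex u. From any other vertex, a path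
  -- reaching distance s would leave a vertex at distance s - 1 whose k neighbours all point back.
  have hi : i + 1 < s := by
    by_contra hle
    obtain ⟨x, hx⟩ := exists_dist_eq_of_le (i := s - 2 + 2) hcon (u := a) (v := v) (by omega)
    obtain ⟨y, hy, hyd⟩ := exists_adj_dist_eq hcon hx
    have h1 := hcount a y (s - 2) (by omega) hyd
    rw [if_pos (by omega)] at h1
    have h2 := nbrsAtDist_add hcon col hreg hyd
    have h3 := nbrsAtDist_pos (u := a) hy.symm
    rw [hx] at h3
    have h4 : (0 : ℝ) < nbrsAtDist G a y (s - 2 + 2) := by exact_mod_cast h3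
    linarith
  exact ⟨by omega, by rw [hcount a v i hi hd, hlow i hi]⟩

end DistanceRegular

/-! ### The bound for all θ and the main theorem -/

/-- The upper bound for the order, and the structure of the graphs attaining it. -/
theorem card_mul_le_of_isSecondLargestEigenvalue {n : ℕ} {G : SimpleGraph (Fin n)}
    [DecidableRel G.Adj] {k m : ℕ} {c θ μ : ℝ} (hk : 2 ≤ k) (hc : 0 < c)
    (hθ : IsSecondLargestEigenvalue (tridiagB k (m + 4) c) θ) (hcon : G.Connected)
    (col : G.Coloring Bool) (hreg : G.IsRegularOfDegree k)
    (hμ : IsSecondLargestEigenvalue (G.adjMatrix ℝ) μ) (hμθ : μ ≤ θ) :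
    (n : ℝ) * c ≤ 2 * (quotPoly (k - 1) c m).eval (k : ℝ) ∧
    ((n : ℝ) * c = 2 * (quotPoly (k - 1) c m).eval (k : ℝ) →
      1 ≤ c ∧ c ≤ k ∧ HasMooreArray G k m c) := by
  have hk' : (2 : ℝ) ≤ k := by exact_mod_cast hk
  have := hcon.nonempty
  rcases exists_cofactor_of_isSecondLargestEigenvalue hk hc hθ with
    ⟨-, hθk, w, hw0, hw, hcof⟩ | ⟨-, hθk⟩ | ⟨hm, -, hθ0⟩
  · obtain ⟨R, hR, hRθ⟩ := exists_roots_charpoly_adjMatrix_eq (by omega) hreg col hμ hμθ hθk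
    obtain ⟨h1, h2⟩ := card_mul_le_of_cofactor hk hc hreg hR hRθ hw0 hw hcof
    rw [Fintype.card_fin] at h1 h2
    refine ⟨h1, fun heq => ?_⟩
    obtain ⟨hR0, hU, hFU⟩ := h2 heq
    have hG := aeval_quotPoly_eq_of_card_eq hk hreg col hR hR0 (by rwa [Fintype.card_fin])
    have harr := hasMooreArray_of_extremal hc hcon col hreg hU hFU hG
    obtain ⟨u, v, huv⟩ := exists_dist_eq_of_extremal hk hcon col hreg hFU
    have hcv := (harr u v (m + 1) huv).2
    rw [if_neg (by omega), if_pos rfl] at hcv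
    have hadd := nbrsAtDist_add hcon col hreg huv
    rw [hcv] at hadd
    refine ⟨?_, ?_, harr⟩
    · obtain ⟨x, hx, hxd⟩ := exists_adj_dist_eq hcon huv
      have := nbrsAtDist_pos (u := u) hx
      rw [hxd] at this
      rw [← hcv]
      exact_mod_cast this
    · have : (0 : ℝ) ≤ nbrsAtDist G u v (m + 1 + 2) := by positivity
      linarith
  · exfalso
    obtain ⟨R, hR, hRθ⟩ := exists_roots_charpoly_adjMatrix_eq (by omega) hreg col hμ hμθ
      (by rw [hθk]; linarith)
    -- |x| ≤ -k is impossible, so the spectrum is just ±k and n = 2, too few vertices for degree k ≥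
    -- 2.
    have hR0 : R = 0 := by
      refine Multiset.eq_zero_of_forall_notMem fun x hx => ?_
      have := hRθ x hx
      have := abs_nonneg x
      linarith
    have htr := (adjMatrix_isHermitian (G := G)).trace_aeval 1
    rw [hR, hR0] at htr
    simp only [map_one, Matrix.trace_one, Fintype.card_fin, eval_one, Multiset.map_cons,
      Multiset.sum_cons, Multiset.map_zero, Multiset.sum_zero] at htr
    have hn : (n : ℝ) = 2 := by rw [htr]; norm_num
    have hn2 : n = 2 := by exact_mod_cast hn
    obtain ⟨u⟩ := this
    have hdeg := G.degree_lt_card_verts u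
    rw [hreg u, Fintype.card_fin] at hdeg
    omega
  · subst hm hθ0
    obtain ⟨R, hR, hRθ⟩ := exists_roots_charpoly_adjMatrix_eq (by omega) hreg col hμ hμθ
      (by linarith)
    -- All eigenvalues other than ±k are 0, so tr A² = nk gives n ≤ 2k. As g(k) = F_3(k) + ck > ck,
    -- the bound is strict.
    have hsum := sum_aeval_mul_aeval hR X X
    have hlhs : ∑ u, ∑ v,
        aeval (G.adjMatrix ℝ) (X : ℝ[X]) u v * aeval (G.adjMatrix ℝ) (X : ℝ[X]) u v = n * k := by
      have : ∀ u v, aeval (G.adjMatrix ℝ) (X : ℝ[X]) u v * aeval (G.adjMatrix ℝ) (X : ℝ[X]) u v =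
          G.adjMatrix ℝ u v := by
        intro u v
        rw [aeval_X, SimpleGraph.adjMatrix_apply]
        split_ifs <;> simp
      simp only [this, sum_adjMatrix hreg]
      simp
    have hR0 : (R.map fun x => (X : ℝ[X]).eval x * (X : ℝ[X]).eval x).sum ≤ 0 := by
      refine Multiset.sum_map_nonpos _ _ fun x hx => ?_
      have : x = 0 := abs_nonpos_iff.1 (hRθ x hx)
      simp [this]
    rw [hlhs] at hsum
    simp only [eval_X] at hsum hR0
    have hn : (n : ℝ) ≤ 2 * k := by
      by_contra! hlt
      nlinarith
    have hlt : (n : ℝ) * c < 2 * (quotPoly (k - 1) c 1).eval (k : ℝ) := by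
      have h1 := nbPoly_eval_pos (q := (k : ℝ) - 1) (x := k) (by linarith) (by linarith) 1
      rw [quotPoly, eval_add, eval_mul, eval_C, chebU_one, eval_X]
      nlinarith
    exact ⟨hlt.le, fun h => absurd h hlt.ne⟩

/-- Graphs with a Moore array realize the extremal order. -/
lemma HasMooreArray.mem_bipartiteOrders {n : ℕ} {G : SimpleGraph (Fin n)} [DecidableRel G.Adj]
    {k m : ℕ} {c θ : ℝ} (hk : 2 ≤ k) (hc : 0 < c)
    (hθ : IsSecondLargestEigenvalue (tridiagB k (m + 4) c) θ) (hcon : G.Connected)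
    (hbip : G.IsBipartite) (hreg : G.IsRegularOfDegree k) (h : HasMooreArray G k m c) :
    n ∈ bipartiteOrders k θ := by
  obtain ⟨-, h1, h2⟩ := hθ.tridiagB hk hc
  obtain ⟨μ, hμ, hμθ⟩ := h.exists_isSecondLargestEigenvalue hk hc hcon
    (hbip.toColoring (by simp)) hreg h1 h2
  refine ⟨G, hcon, hbip, ?_, μ, ?_, hμθ⟩
  · convert hreg
  · convert hμ

theorem mainTheorem1 (k t : ℕ) (hk : 2 ≤ k) (ht : 4 ≤ t) (c : ℝ) (hc : 0 < c) (θ : ℝ)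
    (hθ : IsSecondLargestEigenvalue (tridiagB k t c) θ) :
    BddAbove (bipartiteOrders k θ) ∧
    (maxBipartiteOrder k θ : ℝ) ≤ boundM k t c ∧
    ((maxBipartiteOrder k θ : ℝ) = boundM k t c ↔
      (1 ≤ c ∧ c < (k : ℝ) ∧ ExistsBipartiteDRG (tridiagB k t c)) ∨
      (c = (k : ℝ) ∧ ExistsBipartiteDRG (tridiagB k (t - 1) 1))) := by
  classical
  obtain ⟨m, rfl⟩ : ∃ m, t = m + 4 := ⟨t - 4, by omega⟩
  have hk' : (2 : ℝ) ≤ k := by exact_mod_cast hk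
  have hM : ∀ x : ℝ, x = boundM k (m + 4) c ↔
      x * c = 2 * (quotPoly (k - 1) c m).eval (k : ℝ) := fun x => by
    rw [boundM_eq k m hc, eq_div_iff hc.ne']
  have hMpos : 0 < boundM k (m + 4) c := by
    rw [boundM_eq k m hc]
    have := quotPoly_eval_pos (q := (k : ℝ) - 1) (x := k) (by linarith) hc (by linarith) m
    positivity
  have hbound : ∀ n ∈ bipartiteOrders k θ, (n : ℝ) ≤ boundM k (m + 4) c := by
    rintro n ⟨G, hcon, hbip, hreg, μ, hμ, hμθ⟩
    rw [boundM_eq k m hc, le_div_iff₀ hc]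
    exact (card_mul_le_of_isSecondLargestEigenvalue hk hc hθ hcon
      (hbip.toColoring (by simp)) hreg hμ hμθ).1
  have hbdd : BddAbove (bipartiteOrders k θ) :=
    ⟨⌊boundM k (m + 4) c⌋₊, fun n hn => Nat.le_floor (hbound n hn)⟩
  have hmax : (maxBipartiteOrder k θ : ℝ) ≤ boundM k (m + 4) c := by
    -- With no admissible graph the supremum is 0, and positivity of the bound suffices.
    rcases (bipartiteOrders k θ).eq_empty_or_nonempty with h | h
    · rw [maxBipartiteOrder, h]; simpa using hMpos.le
    · exact hbound _ (Nat.sSup_mem h hbdd)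
  have hattain : ∀ {n : ℕ} {G : SimpleGraph (Fin n)}, G.Connected → G.IsBipartite →
      G.IsRegularOfDegree k → HasMooreArray G k m c →
      (maxBipartiteOrder k θ : ℝ) = boundM k (m + 4) c := by
    intro n G hcon hbip hreg harr
    refine le_antisymm hmax ?_
    have h1 := harr.card_mul hk hcon (hbip.toColoring (by simp)) hreg
    rw [← (hM n).2 h1]
    exact_mod_cast le_csSup hbdd (harr.mem_bipartiteOrders hk hc hθ hcon hbip hreg)
  refine ⟨hbdd, hmax, fun heq => ?_, ?_⟩
  · have hne : (bipartiteOrders k θ).Nonempty := by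
      by_contra h
      rw [Set.not_nonempty_iff_eq_empty] at h
      rw [maxBipartiteOrder, h] at heq
      simp at heq
      linarith
    obtain ⟨G, hcon, hbip, hreg, μ, hμ, hμθ⟩ := Nat.sSup_mem hne hbdd
    have col : G.Coloring Bool := hbip.toColoring (by simp)
    obtain ⟨h1, h2, harr⟩ := (card_mul_le_of_isSecondLargestEigenvalue hk hc hθ hcon col hreg
      hμ hμθ).2 ((hM _).1 heq)
    obtain ⟨hlt, heq'⟩ := harr.existsBipartiteDRG hk hcon hbip col hreg
    rcases h2.lt_or_eq with h | h
    · exact Or.inl ⟨h1, h, hlt h⟩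
    · exact Or.inr ⟨h, heq' h⟩
  · rintro (⟨-, -, n, G, hbip, hdr, u, hQ⟩ | ⟨rfl, n, G, hbip, hdr, u, hQ⟩)
    · obtain ⟨hreg, harr⟩ := hQ.hasMooreArray (m := m) (c := c) (by omega) le_rfl hdr hbip
        (fun i hi => by split_ifs <;> first | rfl | omega)
      exact hattain hdr.1 hbip hreg harr
    -- The last lower entry k of B(k,m+3,1) sits at distance m + 2, where it plays the role of c.
    · obtain ⟨hreg, harr⟩ := hQ.hasMooreArray (m := m) (c := k) (by omega) (by omega) hdr hbip
        (fun i hi => by split_ifs <;> first | rfl | omega)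
      exact hattain hdr.1 hbip hreg harr
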